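/- Let $\ell = 2k+1 \ge 5$ be an odd integer, write $e(x) = e^{2\pi i x}$, $q^x = e(x\tau)$, $\zeta_\ell = e(1/\ell)$ and $\zeta_\ell^{-j/2} = e(-j/(2\ell))$. For $0 < a < 1$ let $$g_{(a,0)}(\tau) = -q^{\frac12\left(a^2 - a + \frac16\right)} \prod_{n=1}^\infty (1 - q^{n-1+a})(1 - q^{n-a})$$ be the Siegel function on the upper half-plane $\mathbb{H}$, and for $1 \le m \le k-1$ let $$s_{\ell,m}(\tau) = \prod_{j=1}^m \frac{g_{(2j/\ell,0)}(\ell\tau)}{g_{(j/\ell,0)}(\ell\tau)}.$$ Let $\mathbb{Q}(\zeta_\ell)^+$ be the maximal real subfield of $\mathbb{Q}(\zeta_\ell)$. Its cyclotomic unit group is the group of those units of its ring of integers that lie in the multiplicative group generated by $\pm\zeta_\ell$ and the numbers $1 - \zeta_\ell^a$, $1 \le a \le \ell-1$. (1) For every $1 \le m \le k-1$, as $\tau$ tends to the cusp $0$ (that is, as $\mathrm{Im}(-1/\tau) \to \infty$), $$\lim_{\tau \to 0} s_{\ell,m}(\tau) = \prod_{j=1}^m \zeta_\ell^{-\frac{j}{2}}\,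 \frac{1 - \zeta_\ell^{2j}}{1 - \zeta_\ell^{j}},$$ and this value lies in the cyclotomic unit group of $\mathbb{Q}(\zeta_\ell)^+$. (2) If moreover $\ell$ is prime, then the subgroup of $\mathbb{C}^\times$ generated by these $k-1$ values has the same rank as the multiplicative group of functions $U_\ell^R = \langle s_{\ell,m} : 1 \le m \le k-1\rangle$. -/

import Mathlib

open Complex UpperHalfPlane Filter Topology NumberField

noncomputable section

/-- `e(z) = exp (2 π i z)`. -/
def e (z : ℂ) : ℂ := Complex.exp (2 * Real.pi * Complex.I * z)

/-- The second Bernoulli polynomial, evaluated at the fractional part of its argument. -/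
def bernoulliTwo (x : ℝ) : ℝ := Int.fract x ^ 2 - Int.fract x + 1 / 6

/-- The Siegel function `g_a(τ)`, `a = (a₁, a₂)`, as a `q`-product with `q ^ x = e(x τ)`.  The product
is indexed by `n - 1 = 0, 1, 2, …`. -/
def siegel (a₁ a₂ : ℝ) (τ : ℂ) : ℂ :=
  -e (bernoulliTwo a₁ / 2 * τ) * e (a₂ * (a₁ - 1) / 2) *
    ∏' n : ℕ, (1 - e ((n + a₁) * τ) * e a₂) * (1 - e ((n + 1 - a₁) * τ) * e (-a₂))

/-- `s_{ℓ,m}(τ) = ∏_{j=1}^m g_{(2j/ℓ,0)}(ℓτ) / g_{(j/ℓ,0)}(ℓτ)` on the upper half-plane. -/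
def sFun (ℓ m : ℕ) (τ : ℍ) : ℂ :=
  ∏ j ∈ Finset.Icc 1 m,
    siegel (2 * j / ℓ) 0 (ℓ * (τ : ℂ)) / siegel (j / ℓ) 0 (ℓ * (τ : ℂ))

lemma norm_e (x : ℝ) (τ : ℂ) : ‖e (x * τ)‖ = Real.exp (-(2 * Real.pi * τ.im) * x) := by
  rw [e, Complex.norm_exp]
  congr 1
  simp
  ring

lemma tprod_one_sub_e_ne_zero (x : ℝ) (hx : 0 < x) {τ : ℂ} (hτ : 0 < τ.im) :
    (Multipliable fun n : ℕ ↦ 1 - e ((n + x) * τ)) ∧ ∏' n : ℕ, (1 - e ((n + x) * τ)) ≠ 0 := by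
  have hn : ∀ n : ℕ, ‖e ((n + x) * τ)‖ =
      Real.exp (-(2 * Real.pi * τ.im) * x) * Real.exp (-(2 * Real.pi * τ.im)) ^ n := by
    intro n
    have := norm_e (n + x) τ
    push_cast at this
    rw [this, ← Real.exp_nat_mul, ← Real.exp_add]
    congr 1
    ring
  have hpos : 0 < 2 * Real.pi * τ.im := by positivity
  have hs : Summable fun n : ℕ ↦ ‖-e ((n + x) * τ)‖ := by
    simp only [norm_neg, hn]
    refine (summable_geometric_of_lt_one (Real.exp_pos _).le ?_).mul_left _
    exact Real.exp_zero ▸ Real.exp_lt_exp.mpr (by linarith)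
  refine ⟨by simpa only [sub_eq_add_neg] using multipliable_one_add_of_summable hs, ?_⟩
  simp only [sub_eq_add_neg]
  refine tprod_one_add_ne_zero_of_summable (fun n ↦ ?_) hs
  intro h
  have h1 : e ((n + x) * τ) = 1 := by linear_combination -h
  have h2 := norm_e (n + x) τ
  push_cast at h2
  rw [h1, norm_one] at h2
  have : Real.exp (-(2 * Real.pi * τ.im) * (n + x)) < 1 := by
    rw [← Real.exp_zero, Real.exp_lt_exp]
    have : 0 < (n : ℝ) + x := by positivity
    nlinarith
  linarith

lemma siegel_ne_zero {a : ℝ} (h0 : 0 < a) (h1 : a < 1) {τ : ℂ} (hτ : 0 < τ.im) :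
    siegel a 0 τ ≠ 0 := by
  have A := tprod_one_sub_e_ne_zero a h0 hτ
  have B := tprod_one_sub_e_ne_zero (1 - a) (by linarith) hτ
  have hfun : (fun n : ℕ ↦ (1 - e ((n + a) * τ) * e (0 : ℝ)) *
      (1 - e ((n + 1 - a) * τ) * e (-(0 : ℝ)))) =
      fun n : ℕ ↦ (1 - e ((n + a) * τ)) * (1 - e ((n + (1 - a : ℝ)) * τ)) := by
    funext n
    have : e 0 = 1 := by simp [e]
    push_cast
    rw [neg_zero, this, mul_one, mul_one, add_sub_assoc]
  rw [siegel, hfun, Multipliable.tprod_mul A.1 B.1]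
  refine mul_ne_zero (mul_ne_zero (neg_ne_zero.mpr (Complex.exp_ne_zero _))
    (Complex.exp_ne_zero _)) (mul_ne_zero A.2 B.2)

lemma sFun_ne_zero {ℓ m : ℕ} (h : 2 * m < ℓ) (τ : ℍ) : sFun ℓ m τ ≠ 0 := by
  refine Finset.prod_ne_zero_iff.mpr fun j hj ↦ ?_
  rw [Finset.mem_Icc] at hj
  have hℓ : (0 : ℝ) < ℓ := by exact_mod_cast (by omega : 0 < ℓ)
  have hj0 : (0 : ℝ) < j := by exact_mod_cast (by omega : 0 < j)
  have hj1 : (2 * j : ℝ) < ℓ := by exact_mod_cast (by omega : 2 * j < ℓ)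
  have hτ : 0 < ((ℓ : ℂ) * (τ : ℂ)).im := by
    simpa using mul_pos hℓ τ.im_pos
  refine div_ne_zero (siegel_ne_zero (by positivity) ?_ hτ) (siegel_ne_zero (by positivity) ?_ hτ)
  · rw [div_lt_one hℓ]; exact hj1
  · rw [div_lt_one hℓ]; linarith

/-- `s_{ℓ,m}` as an element of the multiplicative group of nowhere vanishing functions on `ℍ`. -/
def sUnit (ℓ m : ℕ) (h : 2 * m < ℓ) : (ℍ → ℂ)ˣ where
  val := sFun ℓ m
  inv := (sFun ℓ m)⁻¹
  val_inv := by funext τ; exact mul_inv_cancel₀ (sFun_ne_zero h τ)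
  inv_val := by funext τ; exact inv_mul_cancel₀ (sFun_ne_zero h τ)

/-- `U_ℓ^R`, for `ℓ = 2k+1`: the group of modular units generated by the `s_{ℓ,m}`,
`1 ≤ m ≤ k - 1`. -/
def groupUR (k : ℕ) : Subgroup (ℍ → ℂ)ˣ :=
  Subgroup.closure {u | ∃ m : ℕ, ∃ h : 2 * m < 2 * k + 1,
    1 ≤ m ∧ m + 1 ≤ k ∧ u = sUnit (2 * k + 1) m h}

/-- The filter of neighbourhoods of the cusp `0` in `ℍ`, generated by the horodiscs
`{τ | A < Im (-1/τ)}` tangent to the real line at `0`. -/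
def atCuspZero : Filter ℍ := atImInfty.comap fun τ ↦ ModularGroup.S • τ

/-- `ζ_ℓ = exp (2 π i / ℓ)`. -/
def zeta (ℓ : ℕ) : ℂ := e (1 / ℓ)

/-- `∏_{j=1}^m ζ_ℓ^{-j/2} (1 - ζ_ℓ^{2j}) / (1 - ζ_ℓ^j)`, where `ζ_ℓ^{-j/2} = exp (-π i j / ℓ)`. -/
def cuspValue (ℓ m : ℕ) : ℂ :=
  ∏ j ∈ Finset.Icc 1 m, e (-(j / (2 * ℓ))) * ((1 - zeta ℓ ^ (2 * j)) / (1 - zeta ℓ ^ j))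

/-- `ℚ(ζ_ℓ)⁺`, the maximal real subfield `ℚ(ζ_ℓ) ∩ ℝ` of the cyclotomic field. -/
def cyclotomicRealField (ℓ : ℕ) : IntermediateField ℚ ℂ :=
  IntermediateField.adjoin ℚ {zeta ℓ} ⊓ (⊥ : IntermediateField ℝ ℂ).restrictScalars ℚ

/-- The group of cyclotomic units of `ℚ(ζ_ℓ)⁺`: the elements of the multiplicative group generated
by `±ζ_ℓ` and the `1 - ζ_ℓ^a`, `1 ≤ a ≤ ℓ - 1`, that are units of the ring of integers of
`ℚ(ζ_ℓ)⁺`. -/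
def cyclotomicUnits (ℓ : ℕ) : Subgroup ℂˣ :=
  Subgroup.closure {u : ℂˣ | (u : ℂ) = zeta ℓ ∨ (u : ℂ) = -zeta ℓ ∨
      ∃ a : ℕ, 1 ≤ a ∧ a < ℓ ∧ (u : ℂ) = 1 - zeta ℓ ^ a} ⊓
    (Units.map (algebraMap (𝓞 (cyclotomicRealField ℓ)) ℂ).toMonoidHom).range

/-- The group generated by the values `cuspValue ℓ m`, `1 ≤ m ≤ k - 1`, for `ℓ = 2k+1`. -/
def groupCuspValues (k : ℕ) : Subgroup ℂˣ :=
  Subgroup.closure {u | ∃ m : ℕ, 1 ≤ m ∧ m + 1 ≤ k ∧ (u : ℂ) = cuspValue (2 * k + 1) m}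

/-- The rank of a commutative group `G`: the rank of `G` as a `ℤ`-module. -/
def abRank (G : Type*) [CommGroup G] : Cardinal := Module.rank ℤ (Additive G)

end

/-! By the Jacobi triple product, `g_(a,0)(w)` is a theta series times `e(B₂(a) w / 2)` and a factor
independent of `a`. The inversion `w ↦ -1/w` of the theta function turns this into `e(-a/2) ∑ (-1)^n
Q^(n(n-1)/2) e(n a)`, `Q = e(-1/w)`, again up to a factor independent of `a`. As `Q → 0` only `n =
0, 1` survive, so quotients of Siegel functions have the stated limits (`tendsto_siegel_div`). Each
factor of the limit is `η^j + η^(-j)` with `η = -ζ^k`, `η² = ζ⁻¹`; it is real and integral, and its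
inverse is a root of unity times a geometric sum.

For the ranks, it suffices that the functions and their values satisfy the same multiplicative
relations (`abRank_closure_range_eq`). Relations pass from functions to values in the limit.
Conversely, a relation between values, raised to the power `2ℓ` to remove the roots of unity, reads
`∏ (1 - ζ^a)^(N a) = 1` with `∑ N a = 0`. Taking logarithms of absolute values of all its conjugates
and pairing with an even character `χ ≠ 1` gives `∑ N a χ⁻¹(a) = 0`, because `∑ χ(a) log |1 - ζ^a|`
is a nonzero multiple of `L(1, χ⁻¹) ≠ 0`. Hence `N` is odd (`odd_of_sum_mul_logCyc_eq_zero`), and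
since `g_(1-a,0) = g_(a,0)` the same exponents give a relation between the functions. -/

noncomputable section

/-! ### The Jacobi triple product -/

/-- The finite `q`-Pochhammer symbol `(q; q)_m = ∏_{i=1}^m (1 - q^i)`. -/
def qPoch (q : ℂ) (m : ℕ) : ℂ := ∏ i ∈ Finset.range m, (1 - q ^ (i + 1))

/-- `1 / (q; q)_m`, extended by `0` to negative `m`. -/
def invQPoch (q : ℂ) (m : ℤ) : ℂ := if m < 0 then 0 else (qPoch q m.toNat)⁻¹

lemma one_sub_pow_ne_zero_of_norm_lt_one {q : ℂ} (hq : ‖q‖ < 1) (i : ℕ) : 1 - q ^ (i + 1) ≠ 0 := by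
  intro h
  have h1 : ‖q ^ (i + 1)‖ < 1 := by
    rw [norm_pow]
    exact pow_lt_one₀ (norm_nonneg _) hq (by omega)
  rw [← sub_eq_zero.mp h, norm_one] at h1
  exact lt_irrefl _ h1

lemma qPoch_succ (q : ℂ) (m : ℕ) : qPoch q (m + 1) = qPoch q m * (1 - q ^ (m + 1)) := by
  rw [qPoch, Finset.prod_range_succ, qPoch]

/-- At `m = 0` both sides vanish, so extension by zero makes the recurrence valid for every integer
and spares case distinctions at the ends of the support. -/
lemma invQPoch_sub_one {q : ℂ} (hq : ‖q‖ < 1) (m : ℤ) :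
    invQPoch q (m - 1) = (1 - q ^ m) * invQPoch q m := by
  rcases lt_trichotomy m 0 with h | h | h
  · simp [invQPoch, h, show m - 1 < 0 by omega]
  · simp [invQPoch, h]
  · obtain ⟨n, rfl⟩ : ∃ n : ℕ, m = (n : ℤ) + 1 := ⟨(m - 1).toNat, by omega⟩
    have h1 : ¬ ((n : ℤ) + 1 < 0) := by omega
    have h2 : ¬ ((n : ℤ) < 0) := by omega
    have h3 : ((n : ℤ) + 1).toNat = n + 1 := by omega
    rw [add_sub_cancel_right, invQPoch, invQPoch, if_neg h1, if_neg h2, h3, Int.toNat_natCast,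
      qPoch_succ, mul_inv]
    have := one_sub_pow_ne_zero_of_norm_lt_one hq n
    have h4 : q ^ ((n : ℤ) + 1) = q ^ (n + 1) := by exact_mod_cast zpow_natCast q (n + 1)
    rw [h4]
    field_simp

/-- The coefficients of the finite form of the Jacobi triple product. -/
def tripleCoeff (q : ℂ) (N : ℕ) (n : ℤ) : ℂ :=
  qPoch q (2 * N) * (invQPoch q (N + n) * invQPoch q (N - n))

/-- A `q`-Pascal rule. Over the common factor `invQPoch q (N+1+n) * invQPoch q (N+1-n)` it is a
polynomial identity in `u = q^(N+1+n)` and `v = q^(N+1-n)`, with `u v = q^(2N+2)`. -/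
lemma tripleCoeff_succ {q : ℂ} (hq : ‖q‖ < 1) (hq0 : q ≠ 0) (N : ℕ) (n : ℤ) :
    tripleCoeff q (N + 1) n = (1 + q ^ (2 * N + 1)) * tripleCoeff q N n +
      q ^ ((N : ℤ) + 1 - n) * tripleCoeff q N (n - 1) +
      q ^ ((N : ℤ) + 1 + n) * tripleCoeff q N (n + 1) := by
  simp only [tripleCoeff]
  rw [show 2 * (N + 1) = 2 * N + 1 + 1 by ring, qPoch_succ, qPoch_succ]
  have e1 : invQPoch q (N + n) = (1 - q ^ ((N : ℤ) + 1 + n)) * invQPoch q ((N : ℤ) + 1 + n) := by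
    rw [← invQPoch_sub_one hq]; congr 1; ring
  have e2 : invQPoch q (N - n) = (1 - q ^ ((N : ℤ) + 1 - n)) * invQPoch q ((N : ℤ) + 1 - n) := by
    rw [← invQPoch_sub_one hq]; congr 1; ring
  have e3 : invQPoch q (N + (n - 1)) = (1 - q ^ ((N : ℤ) + 1 + n) / q) * invQPoch q (N + n) := by
    rw [div_eq_mul_inv, ← zpow_sub_one₀ hq0, show (N : ℤ) + 1 + n - 1 = N + n by ring,
      ← invQPoch_sub_one hq]
    congr 1; ring
  have e4 : invQPoch q (N - (n + 1)) = (1 - q ^ ((N : ℤ) + 1 - n) / q) * invQPoch q (N - n) := by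
    rw [div_eq_mul_inv, ← zpow_sub_one₀ hq0, show (N : ℤ) + 1 - n - 1 = N - n by ring,
      ← invQPoch_sub_one hq]
    congr 1; ring
  have e5 : q ^ (2 * N + 1 + 1) = q ^ ((N : ℤ) + 1 + n) * q ^ ((N : ℤ) + 1 - n) := by
    rw [← zpow_add₀ hq0, ← zpow_natCast]
    congr 1
    push_cast
    ring
  have e6 : q ^ (2 * N + 1) = q ^ ((N : ℤ) + 1 + n) * q ^ ((N : ℤ) + 1 - n) / q := by
    rw [← e5, pow_succ _ (2 * N + 1), mul_div_assoc, div_self hq0, mul_one]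
  rw [show (N : ℤ) - (n - 1) = N + 1 - n by ring, show (N : ℤ) + (n + 1) = N + 1 + n by ring,
    e3, e4, e1, e2, e5, e6]
  push_cast
  generalize q ^ ((N : ℤ) + 1 + n) = u
  generalize q ^ ((N : ℤ) + 1 - n) = v
  field_simp
  ring

/-- The new factor is `(1 + q^(2N+1)) - q^N x - q^(N+1)/x`; its last two terms shift `n` by one,
which the recursion of `t` converts into the powers of `q` in `tripleCoeff_succ`. Describing `t` by
its recursion avoids the exponent `n(n-1)/2`. -/
lemma hasSum_tripleCoeff {q x : ℂ} (hq : ‖q‖ < 1) (hq0 : q ≠ 0) (hx : x ≠ 0) {t : ℤ → ℂ}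
    (t0 : t 0 = 1) (ht : ∀ n, t (n + 1) = -q ^ n * x * t n) (N : ℕ) :
    HasSum (fun n ↦ t n * tripleCoeff q N n)
      (∏ i ∈ Finset.range N, (1 - q ^ i * x) * (1 - q ^ (i + 1) / x)) := by
  induction N with
  | zero =>
    convert hasSum_single (f := fun n ↦ t n * tripleCoeff q 0 n) 0 ?_ using 1
    · simp [tripleCoeff, t0, invQPoch, qPoch]
    · intro n hn
      rcases lt_or_gt_of_ne hn with h | h
      · simp [tripleCoeff, invQPoch, h]
      · simp [tripleCoeff, invQPoch, h]
  | succ N ih =>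
    have hm := ((Equiv.subRight (1 : ℤ)).hasSum_iff.mpr ih).mul_left (-(q ^ N * x))
    have hp := ((Equiv.addRight (1 : ℤ)).hasSum_iff.mpr ih).mul_left (-(q ^ (N + 1) / x))
    have hsum := ((ih.mul_left (1 + q ^ (2 * N + 1))).add hm).add hp
    have hval : ∏ i ∈ Finset.range (N + 1), (1 - q ^ i * x) * (1 - q ^ (i + 1) / x) =
        (1 + q ^ (2 * N + 1)) * ∏ i ∈ Finset.range N, (1 - q ^ i * x) * (1 - q ^ (i + 1) / x) +
        -(q ^ N * x) * ∏ i ∈ Finset.range N, (1 - q ^ i * x) * (1 - q ^ (i + 1) / x) +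
        -(q ^ (N + 1) / x) * ∏ i ∈ Finset.range N, (1 - q ^ i * x) * (1 - q ^ (i + 1) / x) := by
      rw [Finset.prod_range_succ, two_mul, pow_succ, pow_add, pow_succ]
      field_simp
      ring_nf
    rw [hval]
    refine (congrArg (HasSum · _) (funext fun n ↦ ?_)).mpr hsum
    have h1 := ht n
    have h2 : q ^ N * x * t (n - 1) = - q ^ ((N : ℤ) + 1 - n) * t n := by
      have h3 := ht (n - 1)
      rw [sub_add_cancel] at h3
      rw [h3, show (N : ℤ) + 1 - n = N - (n - 1) by ring, zpow_sub₀ hq0, zpow_natCast]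
      have := zpow_ne_zero (n - 1) hq0
      field_simp
    have h4 : q ^ (N + 1) / x * t (n + 1) = - q ^ ((N : ℤ) + 1 + n) * t n := by
      rw [h1, zpow_add₀ hq0, show q ^ ((N : ℤ) + 1) = q ^ (N + 1) by
        exact_mod_cast zpow_natCast q (N + 1)]
      field_simp
    simp only [Function.comp, Equiv.subRight_apply, Equiv.coe_addRight]
    rw [tripleCoeff_succ hq hq0]
    linear_combination (tripleCoeff q N (n - 1)) * h2 + (tripleCoeff q N (n + 1)) * h4

lemma summable_norm_pow_succ {q : ℂ} (hq : ‖q‖ < 1) : Summable fun i : ℕ ↦ ‖-q ^ (i + 1)‖ := by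
  simp only [norm_neg, norm_pow]
  simp only [pow_succ]
  exact (summable_geometric_of_lt_one (norm_nonneg _) hq).mul_right _

lemma exists_tendsto_qPoch {q : ℂ} (hq : ‖q‖ < 1) :
    ∃ c : ℂ, c ≠ 0 ∧ Tendsto (qPoch q) atTop (𝓝 c) := by
  have hs := summable_norm_pow_succ hq
  refine ⟨∏' i : ℕ, (1 + -q ^ (i + 1)), tprod_one_add_ne_zero_of_summable (fun i ↦ ?_) hs, ?_⟩
  · simpa only [sub_eq_add_neg] using one_sub_pow_ne_zero_of_norm_lt_one hq i
  · refine (multipliable_one_add_of_summable hs).tendsto_prod_tprod_nat.congr fun m ↦ ?_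
    simp only [qPoch, sub_eq_add_neg]

lemma tendsto_invQPoch {q : ℂ} {c : ℂ} (hc : c ≠ 0)
    (h : Tendsto (qPoch q) atTop (𝓝 c)) : Tendsto (invQPoch q) atTop (𝓝 c⁻¹) := by
  have h1 : Tendsto (fun m : ℤ ↦ (qPoch q m.toNat)⁻¹) atTop (𝓝 c⁻¹) :=
    (h.comp (show Tendsto Int.toNat atTop atTop from
      tendsto_atTop_atTop.mpr fun b ↦ ⟨b, fun a ha ↦ by omega⟩)).inv₀ hc
  refine h1.congr' ?_
  filter_upwards [eventually_ge_atTop 0] with m hm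
  rw [invQPoch, if_neg (not_lt.mpr hm)]

lemma tendsto_tripleCoeff {q : ℂ} {c : ℂ} (hc : c ≠ 0)
    (h : Tendsto (qPoch q) atTop (𝓝 c)) (n : ℤ) :
    Tendsto (fun N ↦ tripleCoeff q N n) atTop (𝓝 c⁻¹) := by
  have h1 : Tendsto (fun N : ℕ ↦ qPoch q (2 * N)) atTop (𝓝 c) :=
    h.comp (tendsto_atTop_atTop.mpr fun b ↦ ⟨b, fun a ha ↦ by omega⟩)
  have h2 : Tendsto (fun N : ℕ ↦ invQPoch q (N + n)) atTop (𝓝 c⁻¹) :=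
    (tendsto_invQPoch hc h).comp
      (tendsto_atTop_atTop.mpr fun b ↦ ⟨(b - n).toNat, fun a ha ↦ by omega⟩)
  have h3 : Tendsto (fun N : ℕ ↦ invQPoch q (N - n)) atTop (𝓝 c⁻¹) :=
    (tendsto_invQPoch hc h).comp
      (tendsto_atTop_atTop.mpr fun b ↦ ⟨(b + n).toNat, fun a ha ↦ by omega⟩)
  have h4 := h1.mul (h2.mul h3)
  rwa [show c * (c⁻¹ * c⁻¹) = c⁻¹ by field_simp] at h4

/-- Uniformity in `N` and `n` provides the dominating series when `N → ∞` in the finite identity. -/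
lemma exists_norm_tripleCoeff_le {q : ℂ} (hq : ‖q‖ < 1) :
    ∃ M : ℝ, ∀ N n, ‖tripleCoeff q N n‖ ≤ M := by
  obtain ⟨c, hc, h⟩ := exists_tendsto_qPoch hq
  obtain ⟨A, hA⟩ := (Metric.isBounded_range_of_tendsto _ h).exists_norm_le
  obtain ⟨B, hB⟩ := (Metric.isBounded_range_of_tendsto _ (h.inv₀ hc)).exists_norm_le
  have hA0 : 0 ≤ A := (norm_nonneg _).trans (hA _ ⟨0, rfl⟩)
  have hB0 : 0 ≤ B := (norm_nonneg _).trans (hB _ ⟨0, rfl⟩)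
  have hr (m : ℤ) : ‖invQPoch q m‖ ≤ B := by
    rw [invQPoch]
    split_ifs
    · simpa using hB0
    · exact hB _ ⟨_, rfl⟩
  refine ⟨A * (B * B), fun N n ↦ ?_⟩
  rw [tripleCoeff, norm_mul, norm_mul]
  have := hA _ ⟨2 * N, rfl⟩
  gcongr
  · exact hr _
  · exact hr _

/-- The Jacobi triple product identity, up to the factor `c = (q; q)_∞`: the sum `∑ t n` is the
theta series `∑ (-1)^n q^(n(n-1)/2) x^n`. -/
lemma exists_tripleProduct {q : ℂ} (hq : ‖q‖ < 1) (hq0 : q ≠ 0) :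
    ∃ c : ℂ, c ≠ 0 ∧ ∀ (x : ℂ) (t : ℤ → ℂ), x ≠ 0 → t 0 = 1 →
      (∀ n, t (n + 1) = -q ^ n * x * t n) → Summable t →
      Tendsto (fun N ↦ ∏ i ∈ Finset.range N, (1 - q ^ i * x) * (1 - q ^ (i + 1) / x)) atTop
        (𝓝 (c * ∑' n, t n)) := by
  obtain ⟨c, hc, h⟩ := exists_tendsto_qPoch hq
  obtain ⟨M, hM⟩ := exists_norm_tripleCoeff_le hq
  refine ⟨c⁻¹, inv_ne_zero hc, fun x t hx t0 ht hs ↦ ?_⟩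
  rw [mul_comm, ← tsum_mul_right]
  simp_rw [← fun N ↦ (hasSum_tripleCoeff hq hq0 hx t0 ht N).tsum_eq]
  refine tendsto_tsum_of_dominated_convergence (bound := fun n ↦ ‖t n‖ * M)
    (hs.norm.mul_right _) (fun n ↦ (tendsto_tripleCoeff hc h n).const_mul _) ?_
  exact Eventually.of_forall fun N n ↦ by
    rw [norm_mul]
    exact mul_le_mul_of_nonneg_left (hM N n) (norm_nonneg _)

/-! ### Siegel functions as theta series, and their limits at the cusp `0` -/

lemma e_add (x y : ℂ) : e (x + y) = e x * e y := by
  rw [e, e, e, ← Complex.exp_add]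
  ring_nf

lemma e_zero : e 0 = 1 := by simp [e]

lemma e_ne_zero (x : ℂ) : e x ≠ 0 := Complex.exp_ne_zero _

lemma e_neg (x : ℂ) : e (-x) = (e x)⁻¹ := by
  rw [e, e, ← Complex.exp_neg]
  ring_nf

lemma e_nat_mul (n : ℕ) (x : ℂ) : e (n * x) = e x ^ n := by
  rw [e, e, ← Complex.exp_nat_mul]
  ring_nf

lemma e_int_mul (n : ℤ) (x : ℂ) : e (n * x) = e x ^ n := by
  rw [e, e, ← Complex.exp_int_mul]
  ring_nf

lemma e_half : e (1 / 2) = -1 := by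
  rw [e, ← Complex.exp_pi_mul_I]
  ring_nf

lemma e_one : e 1 = 1 := by
  rw [e, mul_one, Complex.exp_two_pi_mul_I]

lemma norm_e_lt_one {w : ℂ} (hw : 0 < w.im) : ‖e w‖ < 1 := by
  have := norm_e 1 w
  rw [ofReal_one, one_mul] at this
  rw [this, Real.exp_lt_one_iff]
  have : 0 < 2 * Real.pi * w.im := by positivity
  linarith

/-- The theta series `∑ (-1)^n q^(n(n-1)/2) e(n z)` with `q = e(w)`. -/
def shiftedTheta (z w : ℂ) : ℂ := jacobiTheta₂ (z + 1 / 2 - w / 2) w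

lemma shiftedTheta_term_eq (n : ℤ) (z w : ℂ) :
    jacobiTheta₂_term n (z + 1 / 2 - w / 2) w =
      e (n * (z + 1 / 2 - w / 2) + n ^ 2 / 2 * w) := by
  rw [jacobiTheta₂_term, e]
  ring_nf

lemma shiftedTheta_term_succ (n : ℤ) (z w : ℂ) :
    jacobiTheta₂_term (n + 1) (z + 1 / 2 - w / 2) w =
      -e w ^ n * e z * jacobiTheta₂_term n (z + 1 / 2 - w / 2) w := by
  rw [shiftedTheta_term_eq, shiftedTheta_term_eq, ← e_int_mul, neg_mul, ← neg_one_mul, ← e_half,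
    ← e_add, ← e_add, ← e_add]
  congr 1
  push_cast
  ring

/-- The Siegel functions `g_(a,0)` in terms of the theta series, by the triple product. -/
lemma exists_siegel_eq_theta {w : ℂ} (hw : 0 < w.im) :
    ∃ c : ℂ, c ≠ 0 ∧ ∀ a : ℝ, 0 < a → a < 1 →
      siegel a 0 w = c * (e (bernoulliTwo a / 2 * w) * shiftedTheta (a * w) w) := by
  obtain ⟨c, hc, h⟩ := exists_tripleProduct (norm_e_lt_one hw) (e_ne_zero w)
  refine ⟨-c, neg_ne_zero.mpr hc, fun a h0 h1 ↦ ?_⟩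
  have A := tprod_one_sub_e_ne_zero a h0 hw
  have B := tprod_one_sub_e_ne_zero (1 - a) (by linarith) hw
  have hlim := h (e (a * w)) (fun n ↦ jacobiTheta₂_term n (a * w + 1 / 2 - w / 2) w)
    (e_ne_zero _) (by simp [jacobiTheta₂_term]) (fun n ↦ shiftedTheta_term_succ n _ _)
    ((summable_jacobiTheta₂_term_iff _ _).mpr hw)
  have hprod := tendsto_nhds_unique hlim
    ((A.1.mul B.1).tendsto_prod_tprod_nat.congr fun N ↦ Finset.prod_congr rfl fun n _ ↦ by
      rw [← e_nat_mul, ← e_nat_mul, div_eq_mul_inv, ← e_neg, ← e_add, ← e_add]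
      push_cast
      ring_nf)
  have hfun : (fun n : ℕ ↦ (1 - e ((n + a) * w) * e (0 : ℝ)) *
      (1 - e ((n + 1 - a) * w) * e (-(0 : ℝ)))) =
      fun n : ℕ ↦ (1 - e ((n + a) * w)) * (1 - e ((n + (1 - a : ℝ)) * w)) := by
    funext n
    push_cast
    rw [neg_zero, e_zero, mul_one, mul_one, add_sub_assoc]
  rw [siegel, hfun, ← hprod, shiftedTheta, jacobiTheta₂]
  simp only [ofReal_zero, zero_mul, zero_div, e_zero]
  ring

lemma bernoulliTwo_of_mem {a : ℝ} (h0 : 0 < a) (h1 : a < 1) :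
    bernoulliTwo a = (a - 1 / 2) ^ 2 - 1 / 12 := by
  rw [bernoulliTwo, Int.fract_eq_self.mpr ⟨h0.le, h1⟩]
  ring

/-- The transformation of the Siegel functions `g_(a,0)` under `w ↦ -1 / w`. -/
lemma exists_siegel_eq_theta_inv {w : ℂ} (hw : 0 < w.im) :
    ∃ c : ℂ, c ≠ 0 ∧ ∀ a : ℝ, 0 < a → a < 1 →
      siegel a 0 w = c * (e (-(a / 2)) * shiftedTheta a (-1 / w)) := by
  obtain ⟨c, hc, h⟩ := exists_siegel_eq_theta hw
  have hw0 : w ≠ 0 := by rintro rfl; simp at hw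
  have hI : (-Complex.I * w) ≠ 0 := mul_ne_zero (neg_ne_zero.mpr I_ne_zero) hw0
  -- The factors of the inversion formula that do not involve `a`; the last one is what remains of
  -- the exponentials once `e(-a/2)` is split off.
  refine ⟨c * (1 / (-Complex.I * w) ^ (1 / 2 : ℂ)) * e (-(w / 24) - 1 / (8 * w) + 1 / 4),
    mul_ne_zero (mul_ne_zero hc (one_div_ne_zero ?_)) (e_ne_zero _), fun a h0 h1 ↦ ?_⟩
  · rw [Complex.cpow_def_of_ne_zero hI]
    exact Complex.exp_ne_zero _
  · have hz : (a * w + 1 / 2 - w / 2) / w = (a + 1 / 2 - (-1 / w) / 2) - 1 := by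
      field_simp
      ring
    have hper : jacobiTheta₂ ((a * w + 1 / 2 - w / 2) / w) (-1 / w) = shiftedTheta a (-1 / w) := by
      rw [shiftedTheta, hz, ← jacobiTheta₂_add_left, sub_add_cancel]
    have hexp : cexp (-Real.pi * Complex.I * (a * w + 1 / 2 - w / 2) ^ 2 / w) =
        e (-((a * w + 1 / 2 - w / 2) ^ 2 / w) / 2) := by
      rw [e]
      ring_nf
    -- The terms quadratic in `a` cancel: `B₂(a) w / 2` contributes `(a - 1/2)² w / 2` and the
    -- inversion its negative.
    have hE : e (bernoulliTwo a / 2 * w) * e (-((a * w + 1 / 2 - w / 2) ^ 2 / w) / 2) =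
        e (-(w / 24) - 1 / (8 * w) + 1 / 4) * e (-(a / 2)) := by
      rw [← e_add, ← e_add, bernoulliTwo_of_mem h0 h1]
      congr 1
      push_cast
      field_simp
      ring
    rw [h a h0 h1, shiftedTheta, jacobiTheta₂_functional_equation, hper, hexp]
    linear_combination c * (1 / (-Complex.I * w) ^ (1 / 2 : ℂ)) * shiftedTheta a (-1 / w) * hE

/-- For real `a` the `n`-th term has norm `exp(-π (n² - n) Im w)`, which is constant for `n = 0, 1`
and tends to `0` otherwise. The terms at `w = i` dominate once `Im w ≥ 1`. -/
lemma tendsto_shiftedTheta (a : ℝ) :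
    Tendsto (fun w ↦ shiftedTheta a w) (comap Complex.im atTop) (𝓝 (1 - e a)) := by
  have hnorm (n : ℤ) (w : ℂ) : ‖jacobiTheta₂_term n (a + 1 / 2 - w / 2) w‖ =
      Real.exp (-Real.pi * (n ^ 2 - n) * w.im) := by
    rw [norm_jacobiTheta₂_term]
    congr 1
    simp
    ring
  have hnn (n : ℤ) : (0 : ℝ) ≤ (n : ℝ) ^ 2 - n := by
    have : (0 : ℤ) ≤ n ^ 2 - n := by nlinarith [mul_self_nonneg (2 * n - 1)]
    exact_mod_cast this
  have hsum : ∑' n : ℤ, (if n = 0 then 1 else if n = 1 then -e a else 0) = 1 - e a := by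
    rw [tsum_eq_sum (s := {0, 1})]
    · simp [sub_eq_add_neg]
    · intro n hn
      simp only [Finset.mem_insert, Finset.mem_singleton, not_or] at hn
      simp [hn]
  rw [← hsum]
  refine tendsto_tsum_of_dominated_convergence
    (bound := fun n : ℤ ↦ ‖jacobiTheta₂_term n (a + 1 / 2 - Complex.I / 2) Complex.I‖)
    ((summable_jacobiTheta₂_term_iff _ _).mpr (by simp)).norm (fun n ↦ ?_) ?_
  · by_cases h0 : n = 0
    · simpa [h0, jacobiTheta₂_term] using tendsto_const_nhds
    by_cases h1 : n = 1
    · subst h1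
      refine tendsto_const_nhds.congr fun w ↦ ?_
      rw [shiftedTheta_term_eq, if_neg h0, if_pos rfl, ← neg_one_mul, ← e_half, ← e_add]
      congr 1
      push_cast
      ring
    · rw [if_neg h0, if_neg h1, tendsto_zero_iff_norm_tendsto_zero]
      simp only [hnorm]
      refine Real.tendsto_exp_atBot.comp ?_
      have hpos : (0 : ℝ) < (n : ℝ) ^ 2 - n := by
        refine lt_of_le_of_ne (hnn n) fun h ↦ ?_
        have h2 : n * (n - 1) = 0 := by
          have : (n : ℝ) * (n - 1) = 0 := by linarith
          exact_mod_cast this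
        rcases mul_eq_zero.mp h2 with h3 | h3 <;> omega
      refine Tendsto.const_mul_atTop_of_neg ?_ tendsto_comap
      have := mul_pos Real.pi_pos hpos
      linarith
  · filter_upwards [tendsto_comap.eventually (eventually_ge_atTop (1 : ℝ))] with w hw n
    rw [hnorm, hnorm, Real.exp_le_exp, Complex.I_im, mul_one]
    have := mul_nonneg Real.pi_pos.le (hnn n)
    nlinarith

/-- The behaviour of a quotient of two Siegel functions at the cusp `0`. -/
lemma tendsto_siegel_div {L : ℕ} (hL : 0 < L) {a b : ℝ} (ha0 : 0 < a) (ha1 : a < 1)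
    (hb0 : 0 < b) (hb1 : b < 1) (hea : e a ≠ 1) :
    Tendsto (fun τ : ℍ ↦ siegel b 0 (L * (τ : ℂ)) / siegel a 0 (L * (τ : ℂ))) atCuspZero
      (𝓝 (e ((a - b) / 2) * ((1 - e b) / (1 - e a)))) := by
  have hL' : (0 : ℝ) < L := by exact_mod_cast hL
  have hcusp : Tendsto (fun τ : ℍ ↦ -1 / ((L : ℂ) * (τ : ℂ))) atCuspZero (comap Complex.im atTop) := by
    rw [tendsto_comap_iff]
    have h1 : Tendsto (fun τ : ℍ ↦ (ModularGroup.S • τ).im) atCuspZero atTop :=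
      (tendsto_comap (f := UpperHalfPlane.im)).comp tendsto_comap
    refine (h1.const_mul_atTop (inv_pos.mpr hL')).congr fun τ ↦ ?_
    have h2 : -1 / ((L : ℂ) * (τ : ℂ)) = (((L : ℝ)⁻¹ : ℝ) : ℂ) * (-(τ : ℂ))⁻¹ := by
      rw [inv_neg]
      push_cast
      rw [neg_div, one_div, mul_inv]
      ring
    rw [modular_S_smul, ← coe_im, Function.comp, h2, im_ofReal_mul]
  have hlim := ((tendsto_shiftedTheta b).comp hcusp).div ((tendsto_shiftedTheta a).comp hcusp)
    (sub_ne_zero.mpr hea.symm)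
  refine (hlim.const_mul (e ((a - b) / 2))).congr fun τ ↦ ?_
  have hτ : 0 < ((L : ℂ) * (τ : ℂ)).im := by simpa using mul_pos hL' τ.im_pos
  obtain ⟨c, hc, h⟩ := exists_siegel_eq_theta_inv hτ
  rw [h a ha0 ha1, h b hb0 hb1, mul_div_mul_left _ _ hc, mul_div_mul_comm]
  congr 1
  rw [eq_div_iff (e_ne_zero _), ← e_add]
  congr 1
  ring

lemma zeta_pow (ℓ j : ℕ) : zeta ℓ ^ j = e (j / ℓ) := by
  rw [zeta, ← e_nat_mul]
  ring_nf

lemma zeta_isPrimitiveRoot {ℓ : ℕ} (h : ℓ ≠ 0) : IsPrimitiveRoot (zeta ℓ) ℓ := by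
  have := Complex.isPrimitiveRoot_exp ℓ h
  rwa [show cexp (2 * Real.pi * Complex.I / ℓ) = zeta ℓ by rw [zeta, e]; ring_nf] at this

lemma tendsto_sFun {ℓ m : ℕ} (h : 2 * m < ℓ) :
    Tendsto (sFun ℓ m) atCuspZero (𝓝 (cuspValue ℓ m)) := by
  refine tendsto_finsetProd _ fun j hj ↦ ?_
  rw [Finset.mem_Icc] at hj
  have hℓ : (0 : ℝ) < ℓ := by exact_mod_cast (by omega : 0 < ℓ)
  have hj0 : (0 : ℝ) < j := by exact_mod_cast (by omega : 0 < j)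
  have hj1 : (2 * j : ℝ) < ℓ := by exact_mod_cast (by omega : 2 * j < ℓ)
  have hne : e ((j / ℓ : ℝ) : ℂ) ≠ 1 := by
    have := (zeta_isPrimitiveRoot (by omega : ℓ ≠ 0)).pow_ne_one_of_pos_of_lt (l := j)
      (by omega) (by omega)
    rw [zeta_pow] at this
    push_cast
    exact this
  have := tendsto_siegel_div (L := ℓ) (by omega) (a := j / ℓ) (b := 2 * j / ℓ) (by positivity)
    (by rw [div_lt_one hℓ]; linarith) (by positivity) (by rw [div_lt_one hℓ]; linarith) hne
  rw [zeta_pow, zeta_pow]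
  push_cast at this ⊢
  have h2 : ((j / ℓ : ℂ) - 2 * j / ℓ) / 2 = -(j / (2 * ℓ)) := by
    have : (ℓ : ℂ) ≠ 0 := by exact_mod_cast hℓ.ne'
    field_simp
    ring
  rwa [h2] at this

/-! ### The exponential zeta function at `1`, by Mellin transforms -/

lemma re_lt_one_of_norm_eq_one {z : ℂ} (h : ‖z‖ = 1) (hz : z ≠ 1) : z.re < 1 := by
  refine lt_of_le_of_ne (h ▸ re_le_norm z) fun h1 ↦ hz ?_
  have h2 : z.re * z.re + z.im * z.im = 1 := by
    rw [← normSq_apply, normSq_eq_norm_sq, h, one_pow]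
  have h3 : z.im = 0 := by
    rw [h1] at h2
    exact mul_self_eq_zero.mp (by linarith)
  exact Complex.ext (by simpa using h1) (by simpa using h3)

/-- Keeps `1 - z e^(-t)` in the right half-plane, where the principal logarithm is differentiable.
-/
lemma re_one_sub_mul_exp_neg_pos {z : ℂ} (h : ‖z‖ = 1) (hz : z ≠ 1) {t : ℝ} (ht : 0 ≤ t) :
    0 < (1 - z * (Real.exp (-t) : ℂ)).re := by
  have h1 := re_lt_one_of_norm_eq_one h hz
  have h2 : Real.exp (-t) ≤ 1 := Real.exp_le_one_iff.mpr (by linarith)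
  have h3 := Real.exp_pos (-t)
  rw [sub_re, one_re, re_mul_ofReal]
  nlinarith

/-- The sum of the geometric series `∑_{n ≥ 1} z^n e^{-nt}`. -/
def expKernel (z : ℂ) (t : ℝ) : ℂ := z * (Real.exp (-t) : ℂ) / (1 - z * (Real.exp (-t) : ℂ))

lemma one_sub_mul_exp_neg_ne_zero {z : ℂ} (h : ‖z‖ = 1) (hz : z ≠ 1) {t : ℝ}
    (ht : 0 ≤ t) : 1 - z * (Real.exp (-t) : ℂ) ≠ 0 := by
  intro h0
  have := re_one_sub_mul_exp_neg_pos h hz ht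
  rw [h0, zero_re] at this
  exact lt_irrefl _ this

lemma continuousOn_expKernel {z : ℂ} (h : ‖z‖ = 1) (hz : z ≠ 1) :
    ContinuousOn (expKernel z) (Set.Ici 0) :=
  ContinuousOn.div (by fun_prop) (by fun_prop) fun _ ht ↦ one_sub_mul_exp_neg_ne_zero h hz ht

lemma expKernel_isBigO_zero {z : ℂ} (h : ‖z‖ = 1) (hz : z ≠ 1) :
    expKernel z =O[𝓝[>] 0] (fun t : ℝ ↦ t ^ (-(0 : ℝ))) := by
  simp only [neg_zero, Real.rpow_zero]
  exact (((continuousOn_expKernel h hz) 0 Set.self_mem_Ici).mono_left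
    (nhdsWithin_mono _ Set.Ioi_subset_Ici_self)).isBigO_one ℝ

lemma tendsto_one_sub_mul_exp_neg (z : ℂ) :
    Tendsto (fun t : ℝ ↦ 1 - z * (Real.exp (-t) : ℂ)) atTop (𝓝 1) := by
  have h1 : Tendsto (fun t : ℝ ↦ (Real.exp (-t) : ℂ)) atTop (𝓝 0) := by
    have := (continuous_ofReal.tendsto (0 : ℝ)).comp Real.tendsto_exp_neg_atTop_nhds_zero
    rwa [ofReal_zero] at this
  simpa using (h1.const_mul z).const_sub 1

lemma expKernel_isBigO_atTop (z : ℂ) :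
    expKernel z =O[atTop] (fun t : ℝ ↦ Real.exp (-1 * t)) := by
  have h1 : (fun t : ℝ ↦ z * (Real.exp (-t) : ℂ)) =O[atTop] (fun t : ℝ ↦ Real.exp (-1 * t)) := by
    refine Asymptotics.IsBigO.of_bound ‖z‖ (Eventually.of_forall fun t ↦ ?_)
    rw [norm_mul, norm_real, neg_one_mul]
  have h2 : (fun t : ℝ ↦ (1 - z * (Real.exp (-t) : ℂ))⁻¹) =O[atTop] (fun _ ↦ (1 : ℝ)) :=
    ((tendsto_one_sub_mul_exp_neg z).inv₀ one_ne_zero).isBigO_one ℝ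
  have h3 := h1.mul h2
  simp only [mul_one] at h3
  exact h3

lemma expKernel_locallyIntegrableOn {z : ℂ} (h : ‖z‖ = 1) (hz : z ≠ 1) :
    MeasureTheory.LocallyIntegrableOn (expKernel z) (Set.Ioi 0) :=
  ((continuousOn_expKernel h hz).mono Set.Ioi_subset_Ici_self).locallyIntegrableOn
    measurableSet_Ioi

/-- At `s = 1` the integrand is the derivative of `log (1 - z e^(-t))`, which goes from `log (1 -
z)` at `0` to `0` at infinity. -/
lemma mellin_expKernel_one {z : ℂ} (h : ‖z‖ = 1) (hz : z ≠ 1) :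
    mellin (expKernel z) 1 = -log (1 - z) := by
  have hint : MeasureTheory.IntegrableOn (expKernel z) (Set.Ioi 0) := by
    have := mellinConvergent_of_isBigO_rpow_exp one_pos (expKernel_locallyIntegrableOn h hz)
      (expKernel_isBigO_atTop z) (expKernel_isBigO_zero h hz) (s := 1) (by simp)
    simpa [MellinConvergent] using this
  have hlim : Tendsto (fun t : ℝ ↦ log (1 - z * (Real.exp (-t) : ℂ))) atTop (𝓝 0) := by
    have := (continuousAt_clog (by simp : (1 : ℂ) ∈ slitPlane)).tendsto.comp
      (tendsto_one_sub_mul_exp_neg z)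
    rwa [log_one] at this
  have hderiv (t : ℝ) (ht : 0 ≤ t) :
      HasDerivAt (fun t : ℝ ↦ log (1 - z * (Real.exp (-t) : ℂ))) (expKernel z t) t := by
    have h1 : HasDerivAt (fun t : ℝ ↦ 1 - z * (Real.exp (-t) : ℂ)) (z * (Real.exp (-t) : ℂ)) t := by
      have h2 := (((Real.hasDerivAt_exp (-t)).comp t (hasDerivAt_neg t)).ofReal_comp.const_mul
        z).const_sub 1
      simpa using h2
    exact h1.clog_real (Or.inl (re_one_sub_mul_exp_neg_pos h hz ht))
  have := MeasureTheory.integral_Ioi_of_hasDerivAt_of_tendsto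
    (hderiv 0 le_rfl).continuousAt.continuousWithinAt (fun t ht ↦ hderiv t (le_of_lt ht)) hint hlim
  simpa [mellin] using this

lemma mellin_expKernel_continuousAt_one {z : ℂ} (h : ‖z‖ = 1) (hz : z ≠ 1) :
    ContinuousAt (mellin (expKernel z)) 1 :=
  (mellin_differentiableAt_of_isBigO_rpow_exp one_pos (expKernel_locallyIntegrableOn h hz)
    (expKernel_isBigO_atTop z) (expKernel_isBigO_zero h hz) (s := 1) (by simp)).continuousAt

lemma hasSum_mellin_expKernel {z : ℂ} (h : ‖z‖ = 1) {s : ℂ} (hs : 1 < s.re) :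
    HasSum (fun n : ℕ ↦ Complex.Gamma s * z ^ (n + 1) / ((n + 1 : ℕ) : ℂ) ^ s)
      (mellin (expKernel z) s) := by
  have := hasSum_mellin (a := fun n : ℕ ↦ z ^ (n + 1)) (p := fun n : ℕ ↦ ((n + 1 : ℕ) : ℝ))
    (F := expKernel z) (s := s) (fun n ↦ Or.inr (by positivity)) (by linarith) ?_ ?_
  · simpa only [ofReal_natCast] using this
  · intro t ht
    have h1 : ‖z * (Real.exp (-t) : ℂ)‖ < 1 := by
      rw [norm_mul, h, one_mul, norm_real, Real.norm_of_nonneg (Real.exp_pos _).le,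
        Real.exp_lt_one_iff]
      exact neg_lt_zero.mpr ht
    have h2 := (hasSum_geometric_of_norm_lt_one h1).mul_left (z * (Real.exp (-t) : ℂ))
    rw [← div_eq_mul_inv] at h2
    refine (congrArg (HasSum · _) (funext fun n ↦ ?_)).mpr h2
    rw [← pow_succ', mul_pow, ← ofReal_pow, ← Real.exp_nat_mul]
    congr 3
    push_cast
    ring
  · simp only [norm_pow, h, one_pow]
    exact (summable_nat_add_iff 1).mpr (Real.summable_one_div_nat_rpow.mpr hs)

/-- The value at `1` of the exponential zeta function. -/
lemma expZeta_one {a : ℝ} (ha : (a : UnitAddCircle) ≠ 0) (hz : e a ≠ 1) :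
    HurwitzZeta.expZeta a 1 = -log (1 - e a) := by
  have h : ‖e a‖ = 1 := by simpa using norm_e a 1
  have heq {s : ℂ} (hs : 1 < s.re) :
      mellin (expKernel (e a)) s = Complex.Gamma s * HurwitzZeta.expZeta a s := by
    have h1 := (HurwitzZeta.hasSum_expZeta_of_one_lt_re a hs).mul_left (Complex.Gamma s)
    -- The term `n = 0` is a division by `0 ^ s = 0`, hence zero, and is dropped.
    rw [← hasSum_nat_add_iff' 1] at h1
    have hs0 : s ≠ 0 := by rintro rfl; simp at hs; linarith
    simp only [Finset.range_one, Finset.sum_singleton, Nat.cast_zero, zero_cpow hs0, div_zero,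
      mul_zero, sub_zero] at h1
    refine (hasSum_mellin_expKernel h hs).unique
      ((congrArg (HasSum · _) (funext fun n ↦ ?_)).mpr h1)
    rw [← e_nat_mul, e, mul_div_assoc]
    congr 3
    push_cast
    ring
  have hcont : ContinuousAt (fun s ↦ Complex.Gamma s * HurwitzZeta.expZeta a s) 1 :=
    (differentiableAt_Gamma_one.mul
      (HurwitzZeta.differentiable_expZeta_of_ne_zero ha 1)).continuousAt
  -- The series identity needs `Re s > 1`; both sides are continuous at `1`, so it extends along `1
  -- + 1/(n+1)`.
  have hseq : Tendsto (fun n : ℕ ↦ (1 : ℂ) + 1 / ((n : ℂ) + 1)) atTop (𝓝 1) := by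
    simpa using (tendsto_one_div_add_atTop_nhds_zero_nat (𝕜 := ℂ)).const_add 1
  have hre (n : ℕ) : 1 < ((1 : ℂ) + 1 / ((n : ℂ) + 1)).re := by
    have : (1 : ℂ) + 1 / ((n : ℂ) + 1) = ((1 + 1 / ((n : ℝ) + 1) : ℝ) : ℂ) := by push_cast; ring
    rw [this, ofReal_re]
    have : 0 < 1 / ((n : ℝ) + 1) := by positivity
    linarith
  have hlim := (mellin_expKernel_continuousAt_one h hz).tendsto.comp hseq
  have := tendsto_nhds_unique hlim ((hcont.tendsto.comp hseq).congr fun n ↦ (heq (hre n)).symm)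
  rw [mellin_expKernel_one h hz, Gamma_one, one_mul] at this
  exact this.symm

/-! ### Logarithms of cyclotomic numbers and `L(1, χ)` -/

/-- `log |1 - ζ_p^a|` for a residue class `a`. -/
def logCyc {p : ℕ} (a : ZMod p) : ℝ := Real.log ‖1 - zeta p ^ a.val‖

lemma isPrimitive_of_prime_level {p : ℕ} (hp : p.Prime) {χ : DirichletCharacter ℂ p} (hχ : χ ≠ 1) :
    χ.IsPrimitive := by
  have : NeZero p := ⟨hp.ne_zero⟩
  rcases (Nat.dvd_prime hp).mp χ.conductor_dvd_level with h | h
  · exact absurd (DirichletCharacter.eq_one_iff_conductor_eq_one.mpr h) hχ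
  · exact h

section

variable {p : ℕ} [Fact p.Prime]

lemma zeta_pow_val_ne_one {a : ZMod p} (ha : a ≠ 0) : zeta p ^ a.val ≠ 1 :=
  (zeta_isPrimitiveRoot (NeZero.ne p)).pow_ne_one_of_pos_of_lt
    ((ZMod.val_ne_zero a).mpr ha) (ZMod.val_lt a)

lemma zeta_pow_val_mul (a b : ZMod p) : (zeta p ^ b.val) ^ a.val = zeta p ^ (a * b).val := by
  rw [ZMod.val_mul, ← pow_mul, ← pow_mod_orderOf,
    ← (zeta_isPrimitiveRoot (NeZero.ne p)).eq_orderOf, mul_comm]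

lemma zeta_pow_val_neg (a : ZMod p) : zeta p ^ (-a).val = (zeta p ^ a.val)⁻¹ := by
  have h1 := (zeta_isPrimitiveRoot (NeZero.ne p)).pow_eq_one
  refine eq_inv_of_mul_eq_one_left ?_
  rw [← pow_add, ← orderOf_dvd_iff_pow_eq_one,
    ← (zeta_isPrimitiveRoot (NeZero.ne p)).eq_orderOf, ← ZMod.natCast_eq_zero_iff]
  simp

lemma norm_zeta_pow (a : ZMod p) : ‖zeta p ^ a.val‖ = 1 := by
  rw [norm_pow, (zeta_isPrimitiveRoot (NeZero.ne p)).norm'_eq_one (NeZero.ne p), one_pow]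

lemma expZeta_toAddCircle_one {a : ZMod p} (ha : a ≠ 0) :
    HurwitzZeta.expZeta (ZMod.toAddCircle a) 1 = -log (1 - zeta p ^ a.val) := by
  have h1 : zeta p ^ a.val = e ((a.val / p : ℝ) : ℂ) := by
    rw [zeta_pow]
    push_cast
    rfl
  rw [h1, ZMod.toAddCircle_apply, expZeta_one]
  · rwa [← ZMod.toAddCircle_apply, ne_eq, ZMod.toAddCircle_eq_zero]
  · rw [← h1]
    exact zeta_pow_val_ne_one ha

/-- On the unit circle `z⁻¹` is the conjugate of `z`, and `1 - z` has positive real part, so the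
logarithms are conjugate and only twice the real part remains. -/
lemma log_one_sub_add_log_one_sub_inv {z : ℂ} (h : ‖z‖ = 1) (hz : z ≠ 1) :
    log (1 - z) + log (1 - z⁻¹) = 2 * (Real.log ‖1 - z‖ : ℂ) := by
  have hconj : 1 - z⁻¹ = (starRingEnd ℂ) (1 - z) := by
    rw [map_sub, map_one, Complex.inv_def, normSq_eq_norm_sq, h]
    simp
  have hre : 0 < (1 - z).re := by
    rw [sub_re, one_re, sub_pos]
    exact re_lt_one_of_norm_eq_one h hz
  have harg : (1 - z).arg ≠ Real.pi := by
    intro h2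
    rw [arg_eq_pi_iff] at h2
    linarith [h2.1]
  rw [hconj, log_conj _ harg, add_conj, log_re]
  push_cast
  rfl

lemma expZeta_add_expZeta_neg {a : ZMod p} (ha : a ≠ 0) :
    HurwitzZeta.expZeta (ZMod.toAddCircle a) 1 + HurwitzZeta.expZeta (ZMod.toAddCircle (-a)) 1 =
      -2 * (logCyc a : ℂ) := by
  rw [expZeta_toAddCircle_one ha, expZeta_toAddCircle_one (neg_ne_zero.mpr ha), zeta_pow_val_neg,
    logCyc]
  linear_combination -log_one_sub_add_log_one_sub_inv (norm_zeta_pow a) (zeta_pow_val_ne_one ha)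

lemma ZMod.LFunction_const_mul {N : ℕ} [NeZero N] (c : ℂ) (Φ : ZMod N → ℂ) (s : ℂ) :
    ZMod.LFunction (fun j ↦ c * Φ j) s = c * ZMod.LFunction Φ s := by
  simp only [ZMod.LFunction, Finset.mul_sum]
  exact Finset.sum_congr rfl fun j _ ↦ by ring

/-- The non-vanishing of `L(1, χ)`, for even `χ`, in terms of logarithms of cyclotomic numbers. -/
lemma sum_char_mul_logCyc_ne_zero {χ : DirichletCharacter ℂ p} (hχ : χ ≠ 1) (heven : χ.Even) :
    ∑ a, χ a * (logCyc a : ℂ) ≠ 0 := by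
  have hp := (Fact.out : p.Prime)
  have hχ0 : χ 0 = 0 := χ.map_zero' hp.ne_one
  have hdft := ZMod.LFunction_dft (N := p) χ (s := 1) (Or.inl hχ0)
  -- A nontrivial character of prime level is primitive, so its Fourier transform is a Gauss sum
  -- times `χ⁻¹`.
  have hF : ZMod.dft (χ : ZMod p → ℂ) = fun k ↦ gaussSum χ ZMod.stdAddChar * χ⁻¹ k := by
    funext k
    have hinv : (χ⁻¹).Even := by
      rw [DirichletCharacter.Even, MulChar.inv_apply, ← heven]
      simp
    rw [(isPrimitive_of_prime_level hp hχ).fourierTransform_eq_inv_mul_gaussSum,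
      hinv.eval_neg, mul_comm]
  rw [hF, ZMod.LFunction_const_mul] at hdft
  have hne : gaussSum χ ZMod.stdAddChar * ZMod.LFunction (χ⁻¹ : DirichletCharacter ℂ p) 1 ≠ 0 :=
    mul_ne_zero (gaussSum_ne_zero_of_nontrivial (by simp [hp.ne_zero]) hχ
      (ZMod.isPrimitive_stdAddChar p))
      (DirichletCharacter.LFunction_apply_one_ne_zero (inv_ne_one.mpr hχ))
  have hsymm : ∑ a, χ a * HurwitzZeta.expZeta (ZMod.toAddCircle (-a)) 1 =
      ∑ a, χ a * HurwitzZeta.expZeta (ZMod.toAddCircle a) 1 := by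
    rw [← Equiv.sum_comp (Equiv.neg (ZMod p))]
    simp only [Equiv.neg_apply, neg_neg, heven.eval_neg]
  have hsum : ∑ a, χ a * (logCyc a : ℂ) =
      -∑ a, χ a * HurwitzZeta.expZeta (ZMod.toAddCircle (-a)) 1 := by
    have : -2 * ∑ a, χ a * (logCyc a : ℂ) =
        ∑ a, χ a * HurwitzZeta.expZeta (ZMod.toAddCircle a) 1 +
        ∑ a, χ a * HurwitzZeta.expZeta (ZMod.toAddCircle (-a)) 1 := by
      rw [Finset.mul_sum, ← Finset.sum_add_distrib]
      refine Finset.sum_congr rfl fun a _ ↦ ?_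
      rcases eq_or_ne a 0 with rfl | ha
      · simp [hχ0]
      · linear_combination -χ a * expZeta_add_expZeta_neg ha
    rw [← hsymm] at this
    linear_combination (-1 / 2) * this
  rw [hsum, ← hdft]
  exact neg_ne_zero.mpr hne

/-- Substitute `c = a b`: characters diagonalize the multiplicative convolution with `logCyc`. -/
lemma sum_char_mul_logCyc_mul (χ : DirichletCharacter ℂ p) {a : ZMod p} (ha : a ≠ 0) :
    ∑ b, χ b * (logCyc (a * b) : ℂ) = χ⁻¹ a * ∑ c, χ c * (logCyc c : ℂ) := by
  rw [← Equiv.sum_comp (Equiv.mulLeft₀ a ha) (fun c ↦ χ c * (logCyc c : ℂ)), Finset.mul_sum]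
  refine Finset.sum_congr rfl fun b _ ↦ ?_
  have h1 : χ⁻¹ a * χ a = 1 := by
    rw [← MulChar.mul_apply, inv_mul_cancel, MulChar.one_apply (isUnit_iff_ne_zero.mpr ha)]
  rw [Equiv.mulLeft₀_apply, map_mul]
  linear_combination (-χ b * (logCyc (a * b) : ℂ)) * h1

/-- The numbers `log |1 - ζ_p^a|` and their conjugates only satisfy the obvious relations. -/
lemma odd_of_sum_mul_logCyc_eq_zero {N : ZMod p → ℤ} (h0 : N 0 = 0) (hsum : ∑ a, N a = 0)
    (h : ∀ b : ZMod p, b ≠ 0 → ∑ a, (N a : ℝ) * logCyc (a * b) = 0) (b : ZMod p) :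
    N (-b) = -N b := by
  have hp := (Fact.out : p.Prime)
  -- The trivial character is covered by `∑ N a = 0`; for the others the paired relations factor,
  -- and the factor `∑ χ(c) log |1 - ζ^c|` is nonzero.
  have heven (χ : DirichletCharacter ℂ p) (hχ : χ.Even) : ∑ a, (N a : ℂ) * χ⁻¹ a = 0 := by
    rcases eq_or_ne χ 1 with rfl | h1
    · have : ∑ a, (N a : ℂ) = 0 := by exact_mod_cast hsum
      rw [← this]
      refine Finset.sum_congr rfl fun a _ ↦ ?_
      rcases eq_or_ne a 0 with rfl | ha
      · simp [h0]
      · rw [inv_one, MulChar.one_apply (isUnit_iff_ne_zero.mpr ha), mul_one]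
    · have h2 : ∑ b, χ b * ∑ a, (N a : ℂ) * (logCyc (a * b) : ℂ) = 0 := by
        refine Finset.sum_eq_zero fun b _ ↦ ?_
        rcases eq_or_ne b 0 with rfl | hb
        · rw [χ.map_zero' hp.ne_one, zero_mul]
        · have : ∑ a, (N a : ℂ) * (logCyc (a * b) : ℂ) = 0 := by exact_mod_cast h b hb
          rw [this, mul_zero]
      have h3 : ∑ b, χ b * ∑ a, (N a : ℂ) * (logCyc (a * b) : ℂ) =
          (∑ a, (N a : ℂ) * χ⁻¹ a) * ∑ c, χ c * (logCyc c : ℂ) := by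
        simp only [Finset.mul_sum (s := Finset.univ) (f := fun a ↦ (N a : ℂ) * _)]
        rw [Finset.sum_comm, Finset.sum_mul]
        refine Finset.sum_congr rfl fun a _ ↦ ?_
        rcases eq_or_ne a 0 with rfl | ha
        · simp [h0]
        · rw [mul_assoc, ← sum_char_mul_logCyc_mul χ ha, Finset.mul_sum]
          exact Finset.sum_congr rfl fun b _ ↦ by ring
      rw [h3] at h2
      exact (mul_eq_zero.mp h2).resolve_right (sum_char_mul_logCyc_ne_zero h1 hχ)
  have hall (χ : DirichletCharacter ℂ p) : ∑ a, ((N a : ℂ) + N (-a)) * χ a = 0 := by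
    have h1 : ∑ a, (N (-a) : ℂ) * χ a = ∑ a, (N a : ℂ) * χ (-a) := by
      rw [← Equiv.sum_comp (Equiv.neg (ZMod p))]
      simp only [Equiv.neg_apply, neg_neg]
    simp only [add_mul, Finset.sum_add_distrib, h1]
    rcases χ.even_or_odd with hχ | hχ
    · have hinv : (χ⁻¹).Even := by
        rw [DirichletCharacter.Even, MulChar.inv_apply, ← hχ]
        simp
      have := heven χ⁻¹ hinv
      rw [inv_inv] at this
      simp only [hχ.eval_neg, this, add_zero]
    · simp [hχ.eval_neg]
  rcases eq_or_ne b 0 with rfl | hb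
  · simp [h0]
  -- Orthogonality of characters recovers `N b + N (-b)` from its vanishing character sums.
  have h4 : ∑ χ : DirichletCharacter ℂ p, χ b⁻¹ * ∑ a, ((N a : ℂ) + N (-a)) * χ a = 0 :=
    Finset.sum_eq_zero fun χ _ ↦ by rw [hall, mul_zero]
  have h5 : ∑ χ : DirichletCharacter ℂ p, χ b⁻¹ * ∑ a, ((N a : ℂ) + N (-a)) * χ a =
      ∑ a, ((N a : ℂ) + N (-a)) * if b = a then (p.totient : ℂ) else 0 := by
    simp only [Finset.mul_sum (s := Finset.univ) (ι := ZMod p)]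
    rw [Finset.sum_comm]
    refine Finset.sum_congr rfl fun a _ ↦ ?_
    rw [← DirichletCharacter.sum_char_inv_mul_char_eq ℂ (isUnit_iff_ne_zero.mpr hb) a,
      Finset.mul_sum]
    exact Finset.sum_congr rfl fun χ _ ↦ by ring
  rw [h5] at h4
  simp only [mul_ite, mul_zero, Finset.sum_ite_eq, Finset.mem_univ, if_true] at h4
  have h6 : (p.totient : ℂ) ≠ 0 := by
    exact_mod_cast (Nat.totient_pos.mpr hp.pos).ne'
  have h7 : (N b : ℂ) + N (-b) = 0 := (mul_eq_zero.mp h4).resolve_right h6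
  have h8 : N b + N (-b) = 0 := by exact_mod_cast h7
  linarith

/-- Irreducibility of the cyclotomic polynomial over `ℚ` allows every primitive root as the image of
`z`. -/
lemma exists_cyclotomic_embedding {K : Type*} [Field K] [Algebra ℚ K]
    [IsCyclotomicExtension {p} ℚ K] {z : K} (hz : IsPrimitiveRoot z p)
    {b : ZMod p} (hb : b ≠ 0) : ∃ σ : K →+* ℂ, σ z = zeta p ^ b.val := by
  have hp := (Fact.out : p.Prime)
  have hprim : IsPrimitiveRoot (zeta p ^ b.val) p := by
    refine (zeta_isPrimitiveRoot hp.ne_zero).pow_of_coprime _ ?_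
    exact (hp.coprime_iff_not_dvd.mpr (Nat.not_dvd_of_pos_of_lt (ZMod.val_pos.mpr hb)
      (ZMod.val_lt b))).symm
  let φ := (hz.embeddingsEquivPrimitiveRoots ℂ
    (Polynomial.cyclotomic.irreducible_rat hp.pos)).symm
    ⟨_, (mem_primitiveRoots hp.pos).mpr hprim⟩
  refine ⟨φ.toRingHom, ?_⟩
  have := hz.embeddingsEquivPrimitiveRoots_apply_coe ℂ
    (Polynomial.cyclotomic.irreducible_rat hp.pos) φ
  rw [Equiv.apply_symm_apply] at this
  exact this.symm

/-- Galois conjugates of a multiplicative relation between the numbers `1 - ζ_p^a`. -/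
lemma sum_mul_logCyc_eq_zero {N : ZMod p → ℤ} (h0 : N 0 = 0)
    (h : ∏ a, (1 - zeta p ^ a.val) ^ N a = 1) {b : ZMod p} (hb : b ≠ 0) :
    ∑ a, (N a : ℝ) * logCyc (a * b) = 0 := by
  let _ : Algebra ℚ (CyclotomicField p ℚ) := CyclotomicField.algebra p ℚ
  obtain ⟨z, hz⟩ : ∃ z : CyclotomicField p ℚ, IsPrimitiveRoot z p :=
    ⟨_, IsCyclotomicExtension.zeta_spec p ℚ (CyclotomicField p ℚ)⟩
  obtain ⟨σ, hσ⟩ := exists_cyclotomic_embedding hz (one_ne_zero (α := ZMod p))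
  obtain ⟨σ', hσ'⟩ := exists_cyclotomic_embedding hz hb
  -- The relation is pulled back along `σ` to the abstract field, then conjugated by `σ'`. The
  -- factor at `a = 0` is `0 ^ 0 = 1`.
  have hK : ∏ a : ZMod p, (1 - z ^ a.val) ^ N a = 1 := by
    refine σ.injective ?_
    simp only [map_prod, map_zpow₀, map_sub, map_one, map_pow, hσ, zeta_pow_val_mul, mul_one]
    exact h
  have hb' := congrArg (fun x ↦ Real.log ‖σ' x‖) hK
  simp only [map_prod, map_zpow₀, map_sub, map_one, map_pow, hσ', zeta_pow_val_mul, norm_one,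
    Real.log_one, norm_prod, norm_zpow] at hb'
  rw [Real.log_prod] at hb'
  · simp only [Real.log_zpow] at hb'
    exact hb'
  · intro a _
    rcases eq_or_ne a 0 with rfl | ha
    · simp [h0]
    · exact zpow_ne_zero _ (norm_ne_zero_iff.mpr (sub_ne_zero.mpr
        (zeta_pow_val_ne_one (mul_ne_zero ha hb)).symm))

end

/-! ### The cusp values as cyclotomic units -/

/-- The factor `ζ_ℓ^{-j/2} (1 - ζ_ℓ^{2j}) / (1 - ζ_ℓ^j) = 2 cos (π j / ℓ)` of `cuspValue`. -/
def cuspFactor (ℓ j : ℕ) : ℂ := e (-(j / (2 * ℓ))) * ((1 - zeta ℓ ^ (2 * j)) / (1 - zeta ℓ ^ j))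

lemma zeta_ne_zero (ℓ : ℕ) : zeta ℓ ≠ 0 := e_ne_zero _

lemma one_sub_zeta_pow_ne_zero {ℓ j : ℕ} (h0 : 0 < j) (hj : j < ℓ) : 1 - zeta ℓ ^ j ≠ 0 :=
  sub_ne_zero.mpr ((zeta_isPrimitiveRoot (by omega)).pow_ne_one_of_pos_of_lt h0.ne' hj).symm

lemma cuspFactor_ne_zero {ℓ j : ℕ} (h0 : 0 < j) (hj : 2 * j < ℓ) : cuspFactor ℓ j ≠ 0 :=
  mul_ne_zero (e_ne_zero _) (div_ne_zero (one_sub_zeta_pow_ne_zero (by omega) hj)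
    (one_sub_zeta_pow_ne_zero h0 (by omega)))

/-- As `2k ≡ -1` modulo `ℓ`, the half-integral power is already a power of `-ζ^k`, hence in `ℚ(ζ)`.
-/
lemma e_neg_half_eq {ℓ k : ℕ} (h : ℓ = 2 * k + 1) (j : ℕ) :
    e (-(j / (2 * ℓ))) = (-zeta ℓ ^ k) ^ j := by
  have hℓ : (ℓ : ℂ) ≠ 0 := by exact_mod_cast (by omega : ℓ ≠ 0)
  have h1 : -zeta ℓ ^ k = e (-(1 / (2 * ℓ))) := by
    have h2 : (1 / 2 + k / ℓ : ℂ) = -(1 / (2 * ℓ)) + 1 := by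
      have : (ℓ : ℂ) = 2 * k + 1 := by exact_mod_cast h
      field_simp
      rw [this]
      ring
    rw [zeta_pow, ← neg_one_mul, ← e_half, ← e_add, h2, e_add, e_one, mul_one]
  rw [h1, ← e_nat_mul]
  congr 1
  field_simp

lemma neg_zeta_pow_sq {ℓ k : ℕ} (h : ℓ = 2 * k + 1) : (-zeta ℓ ^ k) ^ 2 * zeta ℓ = 1 := by
  rw [neg_sq, ← pow_mul, ← pow_succ, mul_comm k, ← h]
  exact (zeta_isPrimitiveRoot (by omega)).pow_eq_one

lemma cuspFactor_eq {ℓ k j : ℕ} (h : ℓ = 2 * k + 1) (h0 : 0 < j) (hj : 2 * j < ℓ) :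
    cuspFactor ℓ j = (-zeta ℓ ^ k) ^ j * (1 + zeta ℓ ^ j) := by
  rw [cuspFactor, e_neg_half_eq h]
  congr 1
  rw [div_eq_iff (one_sub_zeta_pow_ne_zero h0 (by omega))]
  ring

lemma conj_cuspFactor {ℓ k j : ℕ} (h : ℓ = 2 * k + 1) (h0 : 0 < j) (hj : 2 * j < ℓ) :
    (starRingEnd ℂ) (cuspFactor ℓ j) = cuspFactor ℓ j := by
  have hz : ‖zeta ℓ‖ = 1 := (zeta_isPrimitiveRoot (by omega)).norm'_eq_one (by omega)
  have hη : ‖-zeta ℓ ^ k‖ = 1 := by rw [norm_neg, norm_pow, hz, one_pow]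
  have hη0 : -zeta ℓ ^ k ≠ 0 := neg_ne_zero.mpr (pow_ne_zero _ (zeta_ne_zero _))
  have h2 : zeta ℓ = ((-zeta ℓ ^ k) ^ 2)⁻¹ := eq_inv_of_mul_eq_one_right (neg_zeta_pow_sq h)
  have h3 : cuspFactor ℓ j = (-zeta ℓ ^ k) ^ j + ((-zeta ℓ ^ k)⁻¹) ^ j := by
    rw [cuspFactor_eq h h0 hj]
    have : zeta ℓ ^ j = (((-zeta ℓ ^ k) ^ 2)⁻¹) ^ j := congrArg (· ^ j) h2
    rw [this]
    generalize -zeta ℓ ^ k = η at hη0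
    rw [mul_add, mul_one, ← mul_pow]
    congr 2
    field_simp
  rw [h3, map_add, map_pow, map_pow, inv_eq_conj hη, conj_conj, add_comm]

lemma cuspFactor_mem_realField {ℓ k j : ℕ} (h : ℓ = 2 * k + 1) (h0 : 0 < j) (hj : 2 * j < ℓ) :
    cuspFactor ℓ j ∈ cyclotomicRealField ℓ := by
  refine ⟨?_, ?_⟩
  · have hz := IntermediateField.mem_adjoin_simple_self ℚ (zeta ℓ)
    rw [cuspFactor_eq h h0 hj]
    exact mul_mem (pow_mem (neg_mem (pow_mem hz _)) _) (add_mem (one_mem _) (pow_mem hz _))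
  · obtain ⟨r, hr⟩ := conj_eq_iff_real.mp (conj_cuspFactor h h0 hj)
    exact IntermediateField.mem_bot.mpr ⟨r, hr.symm⟩

lemma isIntegral_zeta {ℓ : ℕ} (h : 0 < ℓ) : IsIntegral ℤ (zeta ℓ) :=
  (zeta_isPrimitiveRoot h.ne').isIntegral h

lemma isIntegral_cuspFactor {ℓ k j : ℕ} (h : ℓ = 2 * k + 1) (h0 : 0 < j) (hj : 2 * j < ℓ) :
    IsIntegral ℤ (cuspFactor ℓ j) := by
  have hz := isIntegral_zeta (by omega : 0 < ℓ)
  rw [cuspFactor_eq h h0 hj]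
  exact ((hz.pow _).neg.pow _).mul (isIntegral_one.add (hz.pow _))

lemma isIntegral_inv_cuspFactor {ℓ k j : ℕ} (h : ℓ = 2 * k + 1) (h0 : 0 < j) (hj : 2 * j < ℓ) :
    IsIntegral ℤ (cuspFactor ℓ j)⁻¹ := by
  have hz := isIntegral_zeta (by omega : 0 < ℓ)
  have h1 : (cuspFactor ℓ j)⁻¹ = (-zeta ℓ ^ k * zeta ℓ) ^ j *
      ∑ i ∈ Finset.range (k + 1), (zeta ℓ ^ (2 * j)) ^ i := by
    -- Since `2(k+1) ≡ 1` modulo `ℓ`, `ζ^j` is the `(k+1)`-st power of `ζ^(2j)`.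
    have hgeom : (1 - zeta ℓ ^ (2 * j)) * ∑ i ∈ Finset.range (k + 1), (zeta ℓ ^ (2 * j)) ^ i =
        1 - zeta ℓ ^ j := by
      rw [mul_neg_geom_sum, ← pow_mul, show 2 * j * (k + 1) = ℓ * j + j by rw [h]; ring, pow_add,
        pow_mul, (zeta_isPrimitiveRoot (by omega)).pow_eq_one, one_pow, one_mul]
    have hη : (-zeta ℓ ^ k) ^ j * (-zeta ℓ ^ k * zeta ℓ) ^ j = 1 := by
      rw [← mul_pow, ← mul_assoc, ← sq, neg_zeta_pow_sq h, one_pow]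
    refine inv_eq_of_mul_eq_one_right ?_
    have hne := one_sub_zeta_pow_ne_zero h0 (by omega : j < ℓ)
    rw [cuspFactor, e_neg_half_eq h, mul_mul_mul_comm, hη, one_mul, div_mul_eq_mul_div, hgeom,
      div_self hne]
  rw [h1]
  exact ((hz.pow _).neg.mul hz).pow _ |>.mul (IsIntegral.sum _ fun i _ ↦ (hz.pow _).pow _)

lemma mem_range_units_of_isIntegral {F : IntermediateField ℚ ℂ} {u : ℂˣ} (hu : (u : ℂ) ∈ F)
    (h : IsIntegral ℤ (u : ℂ)) (h' : IsIntegral ℤ (u : ℂ)⁻¹) :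
    u ∈ (Units.map (algebraMap (𝓞 F) ℂ).toMonoidHom).range := by
  have hint {x : ℂ} (hx : x ∈ F) (hi : IsIntegral ℤ x) : IsIntegral ℤ (⟨x, hx⟩ : F) :=
    (isIntegral_algHom_iff (F.val.restrictScalars ℤ) F.val.injective).mp hi
  let a : 𝓞 F := ⟨⟨u, hu⟩, hint hu h⟩
  let b : 𝓞 F := ⟨⟨(u : ℂ)⁻¹, inv_mem hu⟩, hint (inv_mem hu) h'⟩
  have hab : a * b = 1 := by
    refine RingOfIntegers.ext (Subtype.ext ?_)
    exact mul_inv_cancel₀ u.ne_zero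
  refine ⟨⟨a, b, hab, by rw [mul_comm, hab]⟩, Units.ext ?_⟩
  rfl

lemma cuspFactor_mem_cyclotomicUnits {ℓ k j : ℕ} (h : ℓ = 2 * k + 1) (h0 : 0 < j)
    (hj : 2 * j < ℓ) :
    Units.mk0 (cuspFactor ℓ j) (cuspFactor_ne_zero h0 hj) ∈ cyclotomicUnits ℓ := by
  refine Subgroup.mem_inf.mpr ⟨?_, mem_range_units_of_isIntegral (cuspFactor_mem_realField h h0 hj)
    (isIntegral_cuspFactor h h0 hj) (isIntegral_inv_cuspFactor h h0 hj)⟩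
  -- The generators are `±ζ` rather than `-1`, so `-ζ^k` is written `(-ζ) ζ^(k-1)`, which needs `k ≥
  -- 1`.
  obtain ⟨k, rfl⟩ : ∃ n, k = n + 1 := ⟨k - 1, by omega⟩
  have hz := zeta_ne_zero ℓ
  have h1 : Units.mk0 (cuspFactor ℓ j) (cuspFactor_ne_zero h0 hj) =
      (Units.mk0 (-zeta ℓ) (neg_ne_zero.mpr hz) * Units.mk0 (zeta ℓ) hz ^ k) ^ j *
      (Units.mk0 (1 - zeta ℓ ^ (2 * j)) (one_sub_zeta_pow_ne_zero (by omega) hj) /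
      Units.mk0 (1 - zeta ℓ ^ j) (one_sub_zeta_pow_ne_zero h0 (by omega))) := by
    refine Units.ext ?_
    simp only [Units.val_mk0, Units.val_mul, Units.val_pow_eq_pow_val, Units.val_div_eq_div_val]
    rw [cuspFactor, e_neg_half_eq h]
    ring
  rw [h1]
  refine mul_mem (pow_mem (mul_mem ?_ (pow_mem ?_ _)) _) (div_mem ?_ ?_) <;>
    refine Subgroup.subset_closure ?_
  · exact Or.inr (Or.inl rfl)
  · exact Or.inl rfl
  · exact Or.inr (Or.inr ⟨2 * j, by omega, hj, rfl⟩)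
  · exact Or.inr (Or.inr ⟨j, h0, by omega, rfl⟩)

/-- `cuspValue` as a unit of `ℂ`. -/
def cuspUnit (ℓ m : ℕ) (h : 2 * m < ℓ) : ℂˣ :=
  ∏ j : Finset.Icc 1 m, Units.mk0 (cuspFactor ℓ j)
    (cuspFactor_ne_zero (Finset.mem_Icc.mp j.2).1 (by have := (Finset.mem_Icc.mp j.2).2; omega))

lemma cuspUnit_val {ℓ m : ℕ} (h : 2 * m < ℓ) : (cuspUnit ℓ m h : ℂ) = cuspValue ℓ m := by
  rw [cuspUnit, Units.coe_prod, cuspValue]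
  exact Finset.prod_coe_sort (Finset.Icc 1 m) (cuspFactor ℓ)

lemma cuspUnit_mem_cyclotomicUnits {ℓ k m : ℕ} (h : ℓ = 2 * k + 1) (hm : 2 * m < ℓ) :
    cuspUnit ℓ m hm ∈ cyclotomicUnits ℓ :=
  prod_mem fun j _ ↦ cuspFactor_mem_cyclotomicUnits h (Finset.mem_Icc.mp j.2).1
    (by have := (Finset.mem_Icc.mp j.2).2; omega)

/-! ### Multiplicative relations and ranks -/

/-- Two families in commutative groups that satisfy the same multiplicative relations generate
groups of the same rank. -/
lemma abRank_closure_range_eq {ι A B : Type} [Fintype ι] [CommGroup A] [CommGroup B] (f : ι → A)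
    (g : ι → B) (h : ∀ n : ι → ℤ, ∏ i, f i ^ n i = 1 ↔ ∏ i, g i ^ n i = 1) :
    abRank (Subgroup.closure (Set.range f)) = abRank (Subgroup.closure (Set.range g)) := by
  -- The generated group is the quotient of `ℤ^ι` by its lattice of relations.
  have key {C : Type} [CommGroup C] (f : ι → C) :
      ∃ L : (ι →₀ ℤ) →ₗ[ℤ] Additive (Subgroup.closure (Set.range f)),
        Function.Surjective L ∧ ∀ n, L n = 0 ↔ ∏ i, f i ^ n i = 1 := by
    have hval (n : ι →₀ ℤ) : (((Finsupp.linearCombination ℤ fun i ↦ Additive.ofMul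
        (⟨f i, Subgroup.subset_closure ⟨i, rfl⟩⟩ : Subgroup.closure (Set.range f))) n).toMul : C) =
        ∏ i, f i ^ n i := by
      rw [Finsupp.linearCombination_apply, Finsupp.sum_fintype _ _ (by simp), toMul_sum,
        Subgroup.val_finsetProd]
      rfl
    refine ⟨Finsupp.linearCombination ℤ fun i ↦ Additive.ofMul
      ⟨f i, Subgroup.subset_closure ⟨i, rfl⟩⟩, fun x ↦ ?_, fun n ↦ ?_⟩
    · obtain ⟨n, hn⟩ := Subgroup.exists_finsupp_of_mem_closure_range f _ x.toMul.2
      refine ⟨n, Additive.toMul.injective (Subtype.ext ?_)⟩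
      rw [hval, hn, Finsupp.prod_fintype _ _ (by simp)]
    · rw [← hval, ← Subgroup.coe_one (Subgroup.closure (Set.range f)), Subtype.coe_inj]
      rfl
  obtain ⟨L, hL, hL0⟩ := key f
  obtain ⟨M, hM, hM0⟩ := key g
  have hker : LinearMap.ker L = LinearMap.ker M := by
    ext n
    rw [LinearMap.mem_ker, LinearMap.mem_ker, hL0, hM0, h]
  exact (((L.quotKerEquivOfSurjective hL).symm.trans (Submodule.quotEquivOfEq _ _ hker)).trans
    (M.quotKerEquivOfSurjective hM)).rank_eq

instance : atCuspZero.NeBot := by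
  refine (inferInstance : atImInfty.NeBot).comap_of_surj fun τ ↦ ⟨ModularGroup.S⁻¹ • τ, ?_⟩
  exact smul_inv_smul _ _

/-- `a ↦ 1 - a` fixes the Bernoulli polynomial and swaps the two factors of the product. -/
lemma siegel_one_sub {a : ℝ} (h0 : 0 < a) (h1 : a < 1) (τ : ℂ) :
    siegel (1 - a) 0 τ = siegel a 0 τ := by
  rw [siegel, siegel, bernoulliTwo_of_mem h0 h1,
    bernoulliTwo_of_mem (by linarith) (by linarith)]
  congr 1
  · simp only [ofReal_zero, zero_mul, zero_div]
    congr 4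
    ring_nf
  · refine tprod_congr fun n ↦ ?_
    simp only [ofReal_zero, neg_zero, e_zero, mul_one, ofReal_sub, ofReal_one]
    rw [mul_comm]
    congr 4 <;> ring_nf

lemma units_fun_ext {u v : (ℍ → ℂ)ˣ}
    (h : ∀ τ, Units.map (Pi.evalMonoidHom (fun _ : ℍ ↦ ℂ) τ) u =
      Units.map (Pi.evalMonoidHom (fun _ : ℍ ↦ ℂ) τ) v) : u = v :=
  Units.ext (funext fun τ ↦ congrArg Units.val (h τ))

/-- Take the limit at the cusp; the limits are nonzero, so negative exponents are harmless. -/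
lemma prod_cuspUnit_eq_one_of_prod_sUnit_eq_one {ι : Type} [Fintype ι] {ℓ : ℕ} {m : ι → ℕ}
    (hm : ∀ i, 2 * m i < ℓ) {n : ι → ℤ} (h : ∏ i, sUnit ℓ (m i) (hm i) ^ n i = 1) :
    ∏ i, cuspUnit ℓ (m i) (hm i) ^ n i = 1 := by
  refine Units.ext ?_
  have h1 (τ : ℍ) : ∏ i, sFun ℓ (m i) τ ^ n i = 1 := by
    have := congrArg (fun u ↦ (Units.map (Pi.evalMonoidHom (fun _ : ℍ ↦ ℂ) τ) u : ℂ)) h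
    simp only [map_prod, map_zpow, Units.coe_prod, Units.val_zpow_eq_zpow_val, map_one,
      Units.val_one] at this
    exact this
  have h2 : Tendsto (fun τ ↦ ∏ i, sFun ℓ (m i) τ ^ n i) atCuspZero
      (𝓝 (∏ i, cuspValue ℓ (m i) ^ n i)) := by
    refine tendsto_finsetProd _ fun i _ ↦ (tendsto_sFun (hm i)).zpow₀ _ (Or.inl ?_)
    rw [← cuspUnit_val (hm i)]
    exact Units.ne_zero _
  simp only [h1] at h2
  simp only [Units.coe_prod, Units.val_zpow_eq_zpow_val, cuspUnit_val, Units.val_one]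
  exact tendsto_nhds_unique h2 tendsto_const_nhds

section

variable {p : ℕ} [Fact p.Prime]

/-- The unit `1 - ζ_p^a` of `ℂ` for a nonzero residue class `a`. -/
def cycUnit (a : ZMod p) : ℂˣ :=
  if ha : a = 0 then 1 else Units.mk0 (1 - zeta p ^ a.val)
    (sub_ne_zero.mpr (zeta_pow_val_ne_one ha).symm)

lemma siegel_residue_ne_zero {a : ZMod p} (ha : a ≠ 0) (τ : ℍ) :
    siegel (a.val / p) 0 (p * (τ : ℂ)) ≠ 0 := by
  have hp : (0 : ℝ) < p := by exact_mod_cast NeZero.pos p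
  refine siegel_ne_zero (div_pos (by exact_mod_cast ZMod.val_pos.mpr ha) hp) ?_ ?_
  · rw [div_lt_one hp]
    exact_mod_cast ZMod.val_lt a
  · simpa using mul_pos hp τ.im_pos

/-- The Siegel function `g_(a/p,0)(pτ)` for a nonzero residue class `a`. -/
def siegelUnit (a : ZMod p) : (ℍ → ℂ)ˣ :=
  if ha : a = 0 then 1 else
    { val := fun τ ↦ siegel (a.val / p) 0 (p * (τ : ℂ))
      inv := fun τ ↦ (siegel (a.val / p) 0 (p * (τ : ℂ)))⁻¹
      val_inv := funext fun τ ↦ mul_inv_cancel₀ (siegel_residue_ne_zero ha τ)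
      inv_val := funext fun τ ↦ inv_mul_cancel₀ (siegel_residue_ne_zero ha τ) }

lemma siegelUnit_neg (a : ZMod p) : siegelUnit (-a) = siegelUnit a := by
  rcases eq_or_ne a 0 with rfl | ha
  · rw [neg_zero]
  have hp : (0 : ℝ) < p := by exact_mod_cast NeZero.pos p
  rw [siegelUnit, siegelUnit, dif_neg ha, dif_neg (neg_ne_zero.mpr ha)]
  refine Units.ext (funext fun τ ↦ ?_)
  have : NeZero a := ⟨ha⟩
  change siegel ((-a).val / p) 0 _ = siegel (a.val / p) 0 _
  rw [ZMod.val_neg_of_ne_zero, Nat.cast_sub (ZMod.val_lt a).le, sub_div, div_self hp.ne',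
    siegel_one_sub]
  · exact div_pos (by exact_mod_cast ZMod.val_pos.mpr ha) hp
  · rw [div_lt_one hp]
    exact_mod_cast ZMod.val_lt a

lemma natCast_zmod_ne_zero {j : ℕ} (h0 : 0 < j) (hj : j < p) : (j : ZMod p) ≠ 0 := by
  rw [ne_eq, ZMod.natCast_eq_zero_iff]
  exact Nat.not_dvd_of_pos_of_lt h0 hj

lemma cycUnit_natCast {j : ℕ} (h0 : 0 < j) (hj : j < p) :
    (cycUnit (j : ZMod p) : ℂ) = 1 - zeta p ^ j := by
  rw [cycUnit, dif_neg (natCast_zmod_ne_zero h0 hj), Units.val_mk0, ZMod.val_natCast_of_lt hj]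

lemma siegelUnit_natCast {j : ℕ} (h0 : 0 < j) (hj : j < p) (τ : ℍ) :
    (siegelUnit (j : ZMod p) : ℍ → ℂ) τ = siegel (j / p) 0 (p * (τ : ℂ)) := by
  rw [siegelUnit, dif_neg (natCast_zmod_ne_zero h0 hj)]
  change siegel ((j : ZMod p).val / p) 0 _ = _
  rw [ZMod.val_natCast_of_lt hj]

lemma sUnit_eq_prod_siegelUnit {m : ℕ} (hm : 2 * m < p) :
    sUnit p m hm = ∏ j ∈ Finset.Icc 1 m,
      siegelUnit ((2 * j : ℕ) : ZMod p) / siegelUnit (j : ZMod p) := by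
  refine units_fun_ext fun τ ↦ Units.ext ?_
  simp only [map_prod, map_div, Units.coe_prod, Units.val_div_eq_div_val, Units.coe_map,
    Pi.evalMonoidHom_apply]
  change ∏ j ∈ Finset.Icc 1 m, siegel (2 * j / p) 0 (p * (τ : ℂ)) / siegel (j / p) 0 (p * (τ : ℂ)) =
    _
  refine Finset.prod_congr rfl fun j hj ↦ ?_
  rw [Finset.mem_Icc] at hj
  rw [siegelUnit_natCast (by omega) (by omega), siegelUnit_natCast (by omega) (by omega)]
  push_cast
  rfl

/-- The power `2p` kills the roots of unity `e(-j/(2p))`. -/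
lemma cuspUnit_pow_eq {m : ℕ} (hm : 2 * m < p) :
    cuspUnit p m hm ^ (2 * p) = (∏ j ∈ Finset.Icc 1 m,
      cycUnit ((2 * j : ℕ) : ZMod p) / cycUnit (j : ZMod p)) ^ (2 * p) := by
  refine Units.ext ?_
  rw [Units.val_pow_eq_pow_val, Units.val_pow_eq_pow_val, cuspUnit_val, cuspValue,
    Units.coe_prod, ← Finset.prod_pow, ← Finset.prod_pow]
  refine Finset.prod_congr rfl fun j hj ↦ ?_
  rw [Finset.mem_Icc] at hj
  have hroot : e (-(j / (2 * p))) ^ (2 * p) = 1 := by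
    have hp : (p : ℂ) ≠ 0 := by exact_mod_cast NeZero.ne p
    rw [← e_nat_mul, show ((2 * p : ℕ) : ℂ) * -(j / (2 * p)) = ((-j : ℤ) : ℂ) * 1 by
      push_cast; field_simp, e_int_mul, e_one, one_zpow]
  rw [mul_pow, hroot, one_mul, Units.val_div_eq_div_val, cycUnit_natCast (by omega) (by omega),
    cycUnit_natCast (by omega) (by omega)]

end

/-- The exponents of `∏_i (∏_{j ≤ m i} h(2j) / h(j)) ^ n i` as a product of values of `h`. -/
def doublingExponent {ι : Type} [Fintype ι] (p : ℕ) (m : ι → ℕ) (n : ι → ℤ) : ZMod p →₀ ℤ :=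
  ∑ i, n i • ∑ j ∈ Finset.Icc 1 (m i),
    (Finsupp.single ((2 * j : ℕ) : ZMod p) 1 - Finsupp.single (j : ZMod p) 1)

section

variable {ι : Type} [Fintype ι] {p : ℕ} [Fact p.Prime] {m : ι → ℕ}

/-- Used for both `cycUnit` and `siegelUnit`: one exponent vector governs values and functions. -/
lemma prod_zpow_doublingExponent {A : Type} [CommGroup A] (h : ZMod p → A) (m : ι → ℕ)
    (n : ι → ℤ) : ∏ a, h a ^ doublingExponent p m n a =
      ∏ i, (∏ j ∈ Finset.Icc 1 (m i), h ((2 * j : ℕ) : ZMod p) / h (j : ZMod p)) ^ n i := by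
  have h1 : Finsupp.linearCombination ℤ (fun a ↦ Additive.ofMul (h a)) (doublingExponent p m n) =
      Additive.ofMul (∏ a, h a ^ doublingExponent p m n a) := by
    rw [Finsupp.linearCombination_apply, Finsupp.sum_fintype _ _ (by simp), ofMul_prod]
    rfl
  apply Additive.ofMul.injective
  rw [← h1, doublingExponent]
  simp only [map_sum, map_smul, map_sub, Finsupp.linearCombination_single, one_smul, ofMul_prod,
    ofMul_zpow, ofMul_div]

lemma doublingExponent_zero (hm : ∀ i, 2 * m i < p) (n : ι → ℤ) :
    doublingExponent p m n 0 = 0 := by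
  rw [doublingExponent, Finsupp.finsetSum_apply]
  refine Finset.sum_eq_zero fun i _ ↦ ?_
  rw [Finsupp.smul_apply, Finsupp.finsetSum_apply, Finset.sum_eq_zero, smul_zero]
  intro j hj
  rw [Finset.mem_Icc] at hj
  have := hm i
  rw [Finsupp.sub_apply, Finsupp.single_eq_of_ne (natCast_zmod_ne_zero (by omega) (by omega)).symm,
    Finsupp.single_eq_of_ne (natCast_zmod_ne_zero (by omega) (by omega)).symm, sub_zero]

/-- Each quotient `h(2j) / h(j)` has degree zero; this settles the trivial character. -/
lemma sum_doublingExponent (m : ι → ℕ) (n : ι → ℤ) : ∑ a, doublingExponent p m n a = 0 := by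
  have h1 : Finsupp.linearCombination ℤ (fun _ : ZMod p ↦ (1 : ℤ)) (doublingExponent p m n) =
      ∑ a, doublingExponent p m n a := by
    rw [Finsupp.linearCombination_apply, Finsupp.sum_fintype _ _ (by simp)]
    simp
  rw [← h1, doublingExponent]
  simp [map_sum]

lemma prod_sUnit_eq_one_of_prod_cuspUnit_eq_one (hm : ∀ i, 2 * m i < p) {n : ι → ℤ}
    (h : ∏ i, cuspUnit p (m i) (hm i) ^ n i = 1) : ∏ i, sUnit p (m i) (hm i) ^ n i = 1 := by
  set N := doublingExponent p m n with hN
  have hN0 : N 0 = 0 := doublingExponent_zero hm n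
  have hp0 : (2 * p : ℤ) ≠ 0 := by
    have := NeZero.ne p
    positivity
  have hrel : ∏ a : ZMod p, cycUnit a ^ ((2 * p : ℤ) * N a) = 1 := by
    calc ∏ a : ZMod p, cycUnit a ^ ((2 * p : ℤ) * N a)
        = (∏ a : ZMod p, cycUnit a ^ N a) ^ (2 * p) := by
          rw [← Finset.prod_pow]
          refine Finset.prod_congr rfl fun a _ ↦ ?_
          rw [mul_comm, zpow_mul]
          exact_mod_cast rfl
      _ = (∏ i, cuspUnit p (m i) (hm i) ^ n i) ^ (2 * p) := by
          rw [hN, prod_zpow_doublingExponent, ← Finset.prod_pow, ← Finset.prod_pow]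
          refine Finset.prod_congr rfl fun i _ ↦ ?_
          rw [← zpow_natCast, ← zpow_natCast, zpow_comm, zpow_comm _ (n i), zpow_natCast,
            zpow_natCast, cuspUnit_pow_eq]
      _ = 1 := by rw [h, one_pow]
  have hrel' : ∏ a : ZMod p, (1 - zeta p ^ a.val) ^ ((2 * p : ℤ) * N a) = 1 := by
    have h1 := congrArg Units.val hrel
    rw [Units.coe_prod, Units.val_one] at h1
    refine Eq.trans (Finset.prod_congr rfl fun a _ ↦ ?_) h1
    rcases eq_or_ne a 0 with rfl | ha
    · simp [hN0]
    · rw [Units.val_zpow_eq_zpow_val, cycUnit, dif_neg ha, Units.val_mk0]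
  have hodd (a : ZMod p) : N (-a) = -N a := by
    have := odd_of_sum_mul_logCyc_eq_zero (N := fun a ↦ (2 * p : ℤ) * N a) (by simp [hN0])
      (by rw [← Finset.mul_sum, sum_doublingExponent, mul_zero])
      (fun b hb ↦ sum_mul_logCyc_eq_zero (by simp [hN0]) hrel' hb) a
    refine mul_left_cancel₀ hp0 ?_
    linarith
  simp only [sUnit_eq_prod_siegelUnit]
  rw [← prod_zpow_doublingExponent siegelUnit m n]
  -- The factors at `a` and `-a` cancel, as `N` is odd and `siegelUnit` even; at a fixed point `N a
  -- = -N a` forces `N a = 0`.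
  refine Finset.prod_involution (fun a _ ↦ -a) (fun a _ ↦ ?_) (fun a _ ha h1 ↦ ha ?_)
    (fun a _ ↦ Finset.mem_univ _) (fun a _ ↦ neg_neg a)
  · rw [siegelUnit_neg, ← hN, hodd, zpow_neg, mul_inv_cancel]
  · have h2 := hodd a
    rw [h1] at h2
    rw [← hN, show N a = 0 by omega, zpow_zero]

end

theorem theorem1p4 (ℓ k : ℕ) (hℓk : ℓ = 2 * k + 1) (hℓ : 5 ≤ ℓ) :
    (∀ m : ℕ, 1 ≤ m → m ≤ k - 1 →
      Tendsto (sFun ℓ m) atCuspZero (𝓝 (cuspValue ℓ m)) ∧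
      ∃ u ∈ cyclotomicUnits ℓ, (u : ℂ) = cuspValue ℓ m) ∧
    (ℓ.Prime → abRank (groupCuspValues k) = abRank (groupUR k)) := by
  refine ⟨fun m hm hmk ↦ ?_, fun hp ↦ ?_⟩
  · have h : 2 * m < ℓ := by omega
    exact ⟨tendsto_sFun h, cuspUnit ℓ m h, cuspUnit_mem_cyclotomicUnits hℓk h, cuspUnit_val h⟩
  · subst hℓk
    have : Fact (2 * k + 1).Prime := ⟨hp⟩
    have hm (i : Fin (k - 1)) : 2 * ((i : ℕ) + 1) < 2 * k + 1 := by omega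
    have h1 : groupCuspValues k =
        Subgroup.closure (Set.range fun i : Fin (k - 1) ↦ cuspUnit (2 * k + 1) (i + 1) (hm i)) := by
      rw [groupCuspValues]
      congr 1
      ext u
      constructor
      · rintro ⟨m, h0, hk, hu⟩
        obtain ⟨m, rfl⟩ : ∃ i, m = i + 1 := ⟨m - 1, by omega⟩
        exact ⟨⟨m, by omega⟩, Units.ext ((cuspUnit_val _).trans hu.symm)⟩
      · rintro ⟨i, rfl⟩
        exact ⟨i + 1, by omega, by omega, cuspUnit_val _⟩
    have h2 : groupUR k =
        Subgroup.closure (Set.range fun i : Fin (k - 1) ↦ sUnit (2 * k + 1) (i + 1) (hm i)) := by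
      rw [groupUR]
      congr 1
      ext u
      constructor
      · rintro ⟨m, h, h0, hk, rfl⟩
        obtain ⟨m, rfl⟩ : ∃ i, m = i + 1 := ⟨m - 1, by omega⟩
        exact ⟨⟨m, by omega⟩, rfl⟩
      · rintro ⟨i, rfl⟩
        exact ⟨i + 1, hm i, by omega, by omega, rfl⟩
    rw [h1, h2]
    exact abRank_closure_range_eq _ _ fun n ↦
      ⟨prod_sUnit_eq_one_of_prod_cuspUnit_eq_one hm, prod_cuspUnit_eq_one_of_prod_sUnit_eq_one hm⟩

end
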